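/- Let $\mathfrak H$ be a right quaternionic Hilbert space (with $\mathbb H$-valued inner product $\langle\cdot|\cdot\rangle$, right $\mathbb H$-linear in the second variable) with a Hilbert basis $(e_m)_{m\ge 0}$. For $q\in\mathbb H$ let $q\cdot\phi=\sum_m e_m\,q\,\langle e_m|\phi\rangle$ be the left multiplication induced by this basis, and let $$\mathsf a\phi=\sum_{m\ge0}e_m\sqrt{m+1}\,\langle e_{m+1}|\phi\rangle,\qquad \mathsf a^\dagger\phi=\sum_{m\ge0}e_{m+1}\sqrt{m+1}\,\langle e_m|\phi\rangle$$ be the annihilation and creation operators, each defined for all $\phi$ for which the series converges. For a right $\mathbb H$-linear operator $T$ write $(q\cdot T)\phi=q\cdot(T\phi)$ for $\phi\in\operatorname{dom}T$, and let $e^{T}$ be the closure of the operator $\phi\mapsto\sum_{n\ge0}T^n\phi/n!$, which is defined for all $\phi$ that lie in the domain of every power $T^n$ and for which the series converges. Sums and products of operators carry their natural domains. Put $$D(q)=e^{\,q\cdot\mathsf a^\dagger-\bar q\cdot\mathsf a},\qquad |\gamma_q\rangle=e^{-|q|^2/2}\sum_{m\ge0}e_m\,\frac{q^m}{\sqrt{m!}}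 .$$ Then for every $q\in\mathbb H$ the operator $D(q)$ is defined on all of $\mathfrak H$, and (i) (normal ordering) $D(q)=e^{-|q|^2/2}\,e^{q\cdot\mathsf a^\dagger}\,e^{-\bar q\cdot\mathsf a}$, (ii) (anti-normal ordering) $D(q)=e^{|q|^2/2}\,e^{-\bar q\cdot\mathsf a}\,e^{q\cdot\mathsf a^\dagger}$. Here each equality means the following. The natural domain of the product on the right contains the right linear span of the basis vectors $e_m$ (so it is dense), $D(q)$ agrees with the product on that whole domain, and $D(q)$ is the closure of the product. Furthermore $|\gamma_q\rangle=D(q)\,|e_0\rangle$. -/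

import Mathlib

open scoped Quaternion RightActions

namespace QuatFock

/-- The inner product of a right quaternionic (pre-)Hilbert space. The right multiplication of a
vector `φ` by a quaternion `q` is written `φ <• q`, that is, `MulOpposite.op q • φ`. Completeness
is added separately by `CompleteSpace`. -/
class RightQuatInnerSpace (H : Type*) [NormedAddCommGroup H] [Module ℍᵐᵒᵖ H] where
  /-- the `ℍ`-valued inner product `⟨f | g⟩` -/
  qinner : H → H → ℍ
  star_qinner : ∀ f g : H, star (qinner f g) = qinner g f
  qinner_self : ∀ f : H, qinner f f = ((‖f‖ ^ 2 : ℝ) : ℍ)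
  qinner_add : ∀ f g h : H, qinner f (g + h) = qinner f g + qinner f h
  qinner_smul : ∀ (f g : H) (q : ℍ), qinner f (g <• q) = qinner f g * q

open RightQuatInnerSpace

section Basic

variable {H : Type*} [NormedAddCommGroup H] [Module ℍᵐᵒᵖ H] [RightQuatInnerSpace H]

theorem qinner_zero (f : H) : qinner f (0 : H) = 0 := by
  have h := qinner_smul f (0 : H) (0 : ℍ)
  simpa using h

theorem qinner_sub (f g h : H) : qinner f (g - h) = qinner f g - qinner f h := by
  have := qinner_add f (g - h) h
  rw [sub_add_cancel] at this
  rw [this, add_sub_cancel_right]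

theorem qinner_sum {ι : Type*} (f : H) (s : Finset ι) (g : ι → H) :
    qinner f (∑ i ∈ s, g i) = ∑ i ∈ s, qinner f (g i) := by
  classical
  induction s using Finset.induction_on with
  | empty => simpa using qinner_zero f
  | insert a s ha ih => rw [Finset.sum_insert ha, Finset.sum_insert ha, qinner_add, ih]

theorem qinner_smul_left (f g : H) (q : ℍ) : qinner (f <• q) g = star q * qinner f g := by
  rw [← star_qinner g, qinner_smul, star_mul, star_qinner]

theorem smul_mul_qinner (g f φ : H) (c : ℍ) (b : ℍᵐᵒᵖ) :
    g <• (c * qinner f (b • φ)) = b • (g <• (c * qinner f φ)) := by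
  have h := qinner_smul f φ b.unop
  rw [MulOpposite.op_unop] at h
  rw [h, smul_smul, ← mul_assoc, MulOpposite.op_mul (c * qinner f φ), MulOpposite.op_unop]

theorem smul_mul_qinner_add (g f φ ψ : H) (c : ℍ) :
    g <• (c * qinner f (φ + ψ)) = g <• (c * qinner f φ) + g <• (c * qinner f ψ) := by
  rw [qinner_add, mul_add, MulOpposite.op_add, add_smul]

theorem coe_sum {ι : Type*} (s : Finset ι) (x : ι → ℝ) :
    ((∑ i ∈ s, x i : ℝ) : ℍ) = ∑ i ∈ s, (x i : ℍ) :=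
  map_sum (algebraMap ℝ ℍ) x s

theorem star_mul_self_eq (q : ℍ) : star q * q = ((‖q‖ ^ 2 : ℝ) : ℍ) := by
  rw [Quaternion.star_mul_self, Quaternion.normSq_eq_norm_mul_self, sq]

theorem norm_smul_right (f : H) (q : ℍ) : ‖f <• q‖ = ‖f‖ * ‖q‖ := by
  have h := qinner_self (f <• q)
  rw [qinner_smul, qinner_smul_left, qinner_self, ← Quaternion.coe_commutes, mul_assoc,
    star_mul_self_eq, ← Quaternion.coe_mul, Quaternion.coe_inj] at h
  rw [← mul_pow] at h
  exact ((pow_left_inj₀ (by positivity) (by positivity) two_ne_zero).1 h).symm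

instance instContinuousConstSMul : ContinuousConstSMul ℍᵐᵒᵖ H where
  continuous_const_smul c := by
    have : LipschitzWith ‖c.unop‖₊ (fun x : H => c • x) := by
      refine LipschitzWith.of_dist_le_mul fun x y => ?_
      have := norm_smul_right (x - y) c.unop
      rw [MulOpposite.op_unop] at this
      rw [dist_eq_norm, dist_eq_norm, ← smul_sub, this, mul_comm]
      rfl
    exact this.continuous

end Basic

/-- A Hilbert basis `e 0, e 1, e 2, …` of a right quaternionic Hilbert space. -/
structure QuatHilbertBasis (H : Type*) [NormedAddCommGroup H] [Module ℍᵐᵒᵖ H]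
    [RightQuatInnerSpace H] where
  /-- the basis vectors -/
  vec : ℕ → H
  orthonormal : ∀ m n : ℕ, qinner (vec m) (vec n) = if m = n then 1 else 0
  dense_span : Dense (Submodule.span ℍᵐᵒᵖ (Set.range vec) : Set H)

section Operators

variable {H : Type*} [NormedAddCommGroup H] [Module ℍᵐᵒᵖ H] [RightQuatInnerSpace H]

theorem norm_sq_sum (e : QuatHilbertBasis H) (s : Finset ℕ) (x : ℕ → ℍ) :
    ‖∑ k ∈ s, e.vec k <• x k‖ ^ 2 = ∑ k ∈ s, ‖x k‖ ^ 2 := by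
  have h := qinner_self (∑ k ∈ s, e.vec k <• x k)
  rw [← Quaternion.coe_inj, ← h, qinner_sum]
  have : ∀ i ∈ s, qinner (∑ k ∈ s, e.vec k <• x k) (e.vec i <• x i) =
      ((‖x i‖ ^ 2 : ℝ) : ℍ) := by
    intro i hi
    rw [← star_qinner, qinner_sum, Finset.sum_eq_single i]
    · rw [qinner_smul, qinner_smul_left, e.orthonormal, if_pos rfl, mul_one, star_mul_self_eq]
      simp
    · intro b _ hb
      rw [qinner_smul, qinner_smul_left, e.orthonormal, if_neg hb.symm]
      simp
    · exact fun h => absurd hi h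
  rw [Finset.sum_congr rfl this, coe_sum]

theorem bessel (e : QuatHilbertBasis H) (s : Finset ℕ) (φ : H) :
    ∑ k ∈ s, ‖qinner (e.vec k) φ‖ ^ 2 ≤ ‖φ‖ ^ 2 := by
  set S : H := ∑ k ∈ s, e.vec k <• qinner (e.vec k) φ with hS
  have h1 : qinner φ S = ((∑ k ∈ s, ‖qinner (e.vec k) φ‖ ^ 2 : ℝ) : ℍ) := by
    have : ∀ i ∈ s, qinner φ (e.vec i <• qinner (e.vec i) φ) =
        ((‖qinner (e.vec i) φ‖ ^ 2 : ℝ) : ℍ) := by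
      intro i _
      rw [qinner_smul, ← star_qinner (e.vec i) φ, star_mul_self_eq]
    rw [hS, qinner_sum, Finset.sum_congr rfl this, coe_sum]
  have h2 : qinner S φ = ((∑ k ∈ s, ‖qinner (e.vec k) φ‖ ^ 2 : ℝ) : ℍ) := by
    rw [← star_qinner, h1, Quaternion.star_coe]
  have h3 := qinner_self (φ - S)
  rw [qinner_sub, ← star_qinner φ, ← star_qinner S, qinner_sub, qinner_sub, star_sub, star_sub,
    star_qinner, star_qinner, star_qinner, star_qinner, h1, h2, qinner_self, qinner_self, hS,
    norm_sq_sum, ← hS] at h3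
  rw [← Quaternion.coe_sub, ← Quaternion.coe_sub, ← Quaternion.coe_sub, Quaternion.coe_inj] at h3
  have := sq_nonneg ‖φ - S‖
  linarith

theorem summable_smul [CompleteSpace H] (e : QuatHilbertBasis H) {x : ℕ → ℍ}
    (hx : Summable fun k => ‖x k‖ ^ 2) : Summable fun k => e.vec k <• x k := by
  rw [summable_iff_vanishing_norm]
  intro ε hε
  obtain ⟨s, hs⟩ := summable_iff_vanishing_norm.1 hx (ε ^ 2) (by positivity)
  refine ⟨s, fun t ht => ?_⟩
  have h := hs t ht
  rw [← norm_sq_sum e, Real.norm_of_nonneg (by positivity)] at h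
  exact lt_of_pow_lt_pow_left₀ 2 hε.le h

theorem summable_leftMul [CompleteSpace H] (e : QuatHilbertBasis H) (q : ℍ) (φ : H) :
    Summable fun k => e.vec k <• (q * qinner (e.vec k) φ) := by
  refine summable_smul e ?_
  simp_rw [norm_mul, mul_pow]
  exact (summable_of_sum_le (fun _ => by positivity) fun s => bessel e s φ).mul_left _

theorem summable_coherent [CompleteSpace H] (e : QuatHilbertBasis H) (q : ℍ) :
    Summable fun m : ℕ => e.vec m <• (((Real.sqrt m.factorial)⁻¹ : ℝ) * q ^ m : ℍ) := by
  refine summable_smul e ((Real.summable_pow_div_factorial (‖q‖ ^ 2)).congr fun m => ?_)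
  rw [norm_mul, mul_pow, norm_pow, Quaternion.norm_coe, norm_inv, inv_pow,
    Real.norm_of_nonneg (Real.sqrt_nonneg _), Real.sq_sqrt (by positivity)]
  ring

/-- The left multiplication `φ ↦ q · φ = ∑ₖ eₖ q ⟨eₖ | φ⟩` induced by the basis `e`. -/
noncomputable def leftMul [CompleteSpace H] (e : QuatHilbertBasis H) (q : ℍ) : H →ₗ[ℍᵐᵒᵖ] H where
  toFun φ := ∑' k, e.vec k <• (q * qinner (e.vec k) φ)
  map_add' φ ψ := by
    rw [← (summable_leftMul e q φ).tsum_add (summable_leftMul e q ψ)]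
    exact tsum_congr fun k => smul_mul_qinner_add _ _ _ _ _
  map_smul' c φ := by
    rw [RingHom.id_apply, ← (summable_leftMul e q φ).tsum_const_smul c]
    exact tsum_congr fun k => smul_mul_qinner _ _ _ _ _

/-- The operator `φ ↦ ∑ₘ e (i m) c(m) ⟨e (j m) | φ⟩` with real coefficients `c`, defined for all
`φ` for which this series converges. -/
noncomputable def seriesOp (e : QuatHilbertBasis H) (i j : ℕ → ℕ) (c : ℕ → ℝ) :
    H →ₗ.[ℍᵐᵒᵖ] H where
  domain :=
    { carrier := {φ | Summable fun m => e.vec (i m) <• ((c m : ℍ) * qinner (e.vec (j m)) φ)}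
      zero_mem' := by
        refine summable_zero.congr fun m => ?_
        rw [qinner_zero, mul_zero, MulOpposite.op_zero, zero_smul]
      add_mem' := fun {φ ψ} hφ hψ =>
        (Summable.add hφ hψ).congr fun m => (smul_mul_qinner_add _ _ _ _ _).symm
      smul_mem' := fun b φ hφ =>
        (Summable.const_smul b hφ).congr fun m => (smul_mul_qinner _ _ _ _ _).symm }
  toFun :=
    { toFun := fun φ => ∑' m, e.vec (i m) <• ((c m : ℍ) * qinner (e.vec (j m)) (φ : H))
      map_add' := fun φ ψ => by
        refine Eq.trans ?_ (Summable.tsum_add φ.2 ψ.2)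
        exact tsum_congr fun k => smul_mul_qinner_add _ _ _ _ _
      map_smul' := fun b φ => by
        refine Eq.trans ?_ (Summable.tsum_const_smul b φ.2)
        exact tsum_congr fun k => smul_mul_qinner _ _ _ _ _ }

/-- The annihilation operator `a = ∑ₘ √(m+1) |eₘ⟩⟨eₘ₊₁|`. -/
noncomputable def annihilation (e : QuatHilbertBasis H) : H →ₗ.[ℍᵐᵒᵖ] H :=
  seriesOp e (fun m => m) (fun m => m + 1) fun m => Real.sqrt (m + 1)

/-- The creation operator `a† = ∑ₘ √(m+1) |eₘ₊₁⟩⟨eₘ|`. -/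
noncomputable def creation (e : QuatHilbertBasis H) : H →ₗ.[ℍᵐᵒᵖ] H :=
  seriesOp e (fun m => m + 1) (fun m => m) fun m => Real.sqrt (m + 1)

/-- The operator `q · T : φ ↦ q · (T φ)`, with the domain of `T`. -/
noncomputable def leftSMul [CompleteSpace H] (e : QuatHilbertBasis H) (q : ℍ)
    (T : H →ₗ.[ℍᵐᵒᵖ] H) : H →ₗ.[ℍᵐᵒᵖ] H :=
  (leftMul e q).compPMap T

/-- The product `S T` of two unbounded operators, with its natural domain
`{φ ∈ dom T | T φ ∈ dom S}`. -/
noncomputable def opMul (S T : H →ₗ.[ℍᵐᵒᵖ] H) : H →ₗ.[ℍᵐᵒᵖ] H where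
  domain :=
    { carrier := {φ | ∃ h : φ ∈ T.domain, T ⟨φ, h⟩ ∈ S.domain}
      zero_mem' := ⟨T.domain.zero_mem, by
        have : T ⟨0, T.domain.zero_mem⟩ = 0 := T.map_zero
        rw [this]
        exact S.domain.zero_mem⟩
      add_mem' := fun {φ ψ} hφ hψ => ⟨T.domain.add_mem hφ.1 hψ.1, by
        have : T ⟨φ + ψ, T.domain.add_mem hφ.1 hψ.1⟩ = T ⟨φ, hφ.1⟩ + T ⟨ψ, hψ.1⟩ :=
          T.map_add ⟨φ, hφ.1⟩ ⟨ψ, hψ.1⟩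
        rw [this]
        exact S.domain.add_mem hφ.2 hψ.2⟩
      smul_mem' := fun b φ hφ => ⟨T.domain.smul_mem b hφ.1, by
        have : T ⟨b • φ, T.domain.smul_mem b hφ.1⟩ = b • T ⟨φ, hφ.1⟩ := T.map_smul b ⟨φ, hφ.1⟩
        rw [this]
        exact S.domain.smul_mem b hφ.2⟩ }
  toFun :=
    { toFun := fun φ => S ⟨T ⟨(φ : H), φ.2.1⟩, φ.2.2⟩
      map_add' := fun φ ψ => by
        rw [← S.map_add]
        congr 1
        exact Subtype.ext (T.map_add ⟨(φ : H), φ.2.1⟩ ⟨(ψ : H), ψ.2.1⟩)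
      map_smul' := fun b φ => by
        rw [RingHom.id_apply, ← S.map_smul]
        congr 1
        exact Subtype.ext (T.map_smul b ⟨(φ : H), φ.2.1⟩) }

/-- The graph of the exponential series `φ ↦ ∑ₙ Tⁿ φ / n!`, defined for those `φ` that lie in the
domain of every power of `T` and for which the series converges; `u n` is `Tⁿ φ`. -/
def expSeriesGraph (T : H →ₗ.[ℍᵐᵒᵖ] H) : Submodule ℍᵐᵒᵖ (H × H) where
  carrier := {p | ∃ u : ℕ → H, u 0 = p.1 ∧ (∀ n, (u n, u (n + 1)) ∈ T.graph) ∧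
    HasSum (fun n => u n <• (((n.factorial : ℝ)⁻¹ : ℝ) : ℍ)) p.2}
  zero_mem' := ⟨fun _ => 0, rfl, fun _ => T.graph.zero_mem, by simp⟩
  add_mem' := by
    rintro p p' ⟨u, h0, hu, hs⟩ ⟨v, h0', hv, hs'⟩
    refine ⟨fun n => u n + v n, by simp [h0, h0'], fun n => T.graph.add_mem (hu n) (hv n), ?_⟩
    have h := hs.add hs'
    simp only [← smul_add] at h
    exact h
  smul_mem' := by
    rintro b p ⟨u, h0, hu, hs⟩
    refine ⟨fun n => b • u n, by simp [h0], fun n => T.graph.smul_mem b (hu n), ?_⟩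
    have h : HasSum _ (b • p).2 := hs.const_smul b
    convert h using 2 with n
    rw [smul_smul, smul_smul]
    congr 1
    apply MulOpposite.unop_injective
    simp only [MulOpposite.unop_mul, MulOpposite.unop_op]
    exact (Quaternion.coe_commutes _ _).symm

/-- The exponential `e ^ T` of an unbounded operator `T` whose exponential series is closable: the
closure of the operator `φ ↦ ∑ₙ Tⁿ φ / n!`, that is, the operator whose graph is the closure in
`H × H` of the graph of the series. -/
noncomputable def opExp (T : H →ₗ.[ℍᵐᵒᵖ] H) : H →ₗ.[ℍᵐᵒᵖ] H :=
  (expSeriesGraph T).topologicalClosure.toLinearPMap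

/-- The displacement operator `D(q) = exp (q · a† - q̄ · a)`. -/
noncomputable def displacement [CompleteSpace H] (e : QuatHilbertBasis H) (q : ℍ) :
    H →ₗ.[ℍᵐᵒᵖ] H :=
  opExp (leftSMul e q (creation e) - leftSMul e (star q) (annihilation e))

/-- The product `e^{-|q|²/2} e^{q · a†} e^{-q̄ · a}`, with its natural domain. -/
noncomputable def normalOrdered [CompleteSpace H] (e : QuatHilbertBasis H) (q : ℍ) :
    H →ₗ.[ℍᵐᵒᵖ] H :=
  leftSMul e ((Real.exp (-‖q‖ ^ 2 / 2) : ℝ) : ℍ)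
    (opMul (opExp (leftSMul e q (creation e))) (opExp (-leftSMul e (star q) (annihilation e))))

/-- The product `e^{|q|²/2} e^{-q̄ · a} e^{q · a†}`, with its natural domain. -/
noncomputable def antiNormalOrdered [CompleteSpace H] (e : QuatHilbertBasis H) (q : ℍ) :
    H →ₗ.[ℍᵐᵒᵖ] H :=
  leftSMul e ((Real.exp (‖q‖ ^ 2 / 2) : ℝ) : ℍ)
    (opMul (opExp (-leftSMul e (star q) (annihilation e))) (opExp (leftSMul e q (creation e))))

/-- The coherent state `|γ_q⟩ = e^{-|q|²/2} ∑ₘ |eₘ⟩ qᵐ / √(m!)`. -/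
noncomputable def coherentState (e : QuatHilbertBasis H) (q : ℍ) : H :=
  (∑' m : ℕ, e.vec m <• (((Real.sqrt m.factorial)⁻¹ : ℝ) * q ^ m : ℍ)) <•
    ((Real.exp (-‖q‖ ^ 2 / 2) : ℝ) : ℍ)

end Operators

end QuatFock

/-! Put X = q·a† and Y = -q̄·a. Left multiplications commute with the shifts, whose coefficients are
real, and q q̄ = q̄ q = |q|² is real; so on finite combinations of the basis [X, Y] = |q|² is a real
scalar and noncommutativity of ℍ plays no further role. In any real algebra such a relation gives
exp(tX) exp(tY) = exp(ct²/2) exp(t(X+Y)) coefficientwise (`sum_divPow_mul_divPow`). A product of j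
ladder operators at level n has size at most M^j √((n+1)⋯(n+j)), so dividing by j! makes every
series absolutely convergent, and the formal identity becomes one of vectors
(`expVec_mem_expGraph_of_commutator`).

Passing to unbounded operators rests on duality. `Represents` traps T between a ladder operator on
finite vectors and the adjoint of the conjugate ladder operator. Hence e^T is paired with the
conjugate exponential on a dense set (`Represents.qinner_exp`), so the exponential series is
closable.

For A = X + Y, which is skew, exp(-A) exp(A) = 1 together with duality makes exp(A) isometric on
finite vectors (`Represents.norm_expVec`). It extends by continuity to the whole space, and the
graph of D(q) is the closure of its finite part. The product lies inside D(q) by moving both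
exponentials to the test vector and using the commutator identity of the adjoints
(`product_le_opExp`). It contains the finite part of D(q), so its closure is all of D(q). Finally a
e₀ = 0, so normal ordering computes D(q)e₀. -/

namespace QuatFock

open RightQuatInnerSpace

/-! ### Formal identity for exponentials with a scalar commutator. -/

section Algebra

open Finset

/-- This is the product rule for d/dt on coefficients: the factor n + 1 splits as p.1 + p.2 on the
antidiagonal. -/
theorem succ_smul_sum_antidiagonal {R : Type*} [AddCommGroup R] [Module ℝ R] (f : ℕ × ℕ → R)
    (n : ℕ) : ((n : ℝ) + 1) • ∑ p ∈ antidiagonal (n + 1), f p =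
      ∑ p ∈ antidiagonal n, (((p.1 : ℝ) + 1) • f (p.1 + 1, p.2) +
        ((p.2 : ℝ) + 1) • f (p.1, p.2 + 1)) := by
  have h1 : ∑ p ∈ antidiagonal (n + 1), (p.1 : ℝ) • f p =
      ∑ p ∈ antidiagonal n, ((p.1 : ℝ) + 1) • f (p.1 + 1, p.2) := by
    rw [Nat.sum_antidiagonal_succ]
    simp
  have h2 : ∑ p ∈ antidiagonal (n + 1), (p.2 : ℝ) • f p =
      ∑ p ∈ antidiagonal n, ((p.2 : ℝ) + 1) • f (p.1, p.2 + 1) := by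
    rw [Nat.sum_antidiagonal_succ']
    simp
  rw [sum_add_distrib, ← h1, ← h2, ← sum_add_distrib, smul_sum]
  refine sum_congr rfl fun p hp => ?_
  rw [← add_smul]
  congr 1
  exact_mod_cast (mem_antidiagonal.1 hp).symm

/-- The Taylor coefficients of `t ↦ exp (c t² / 2)` at `0`. -/
noncomputable def gaussCoeff (c : ℝ) : ℕ → ℝ
  | 0 => 1
  | 1 => 0
  | n + 2 => c / (n + 2) * gaussCoeff c n

theorem gaussCoeff_even (c : ℝ) (l : ℕ) :
    gaussCoeff c (2 * l) = (c / 2) ^ l / l.factorial := by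
  induction l with
  | zero => simp [gaussCoeff]
  | succ l ih =>
    rw [show 2 * (l + 1) = 2 * l + 2 by ring, gaussCoeff, ih, Nat.factorial_succ]
    have : (l.factorial : ℝ) ≠ 0 := by positivity
    push_cast
    field_simp
    ring

theorem gaussCoeff_odd (c : ℝ) (l : ℕ) : gaussCoeff c (2 * l + 1) = 0 := by
  induction l with
  | zero => simp [gaussCoeff]
  | succ l ih => rw [show 2 * (l + 1) + 1 = 2 * l + 1 + 2 by ring, gaussCoeff, ih, mul_zero]

theorem hasSum_gaussCoeff (c : ℝ) : HasSum (gaussCoeff c) (Real.exp (c / 2)) := by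
  have h1 : HasSum (fun l => gaussCoeff c (2 * l)) (Real.exp (c / 2)) := by
    simp_rw [gaussCoeff_even, Real.exp_eq_exp_ℝ]
    exact NormedSpace.expSeries_div_hasSum_exp (c / 2)
  have h2 : HasSum (fun l => gaussCoeff c (2 * l + 1)) 0 := by
    simp_rw [gaussCoeff_odd]
    exact hasSum_zero
  simpa using h1.even_add_odd h2

variable {R : Type*} [Ring R] [Algebra ℝ R]

theorem commutator_swap {X Y : R} {c : ℝ} (h : X * Y - Y * X = c • 1) :
    Y * X - X * Y = (-c) • 1 := by
  rw [neg_smul, ← h, neg_sub]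

theorem neg_self_commutator (X : R) : -X * X - X * -X = (0 : ℝ) • 1 := by
  simp

/-- `Xⁿ / n!` -/
noncomputable def divPow (X : R) (n : ℕ) : R := (n.factorial : ℝ)⁻¹ • X ^ n

theorem divPow_zero (X : R) : divPow X 0 = 1 := by simp [divPow]

theorem succ_smul_divPow_succ (X : R) (n : ℕ) :
    ((n : ℝ) + 1) • divPow X (n + 1) = X * divPow X n := by
  have : ((n : ℝ) + 1) ≠ 0 := by positivity
  rw [divPow, divPow, smul_smul, mul_smul_comm, pow_succ', Nat.factorial_succ]
  congr 1
  push_cast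
  field_simp

theorem divPow_one (X : R) : divPow X 1 = X := by simp [divPow]

/-- Commuting with Y is a derivation that sends X to a central scalar, so it acts on powers of X as
c·d/dX. -/
theorem divPow_succ_mul_sub {X Y : R} {c : ℝ} (h : X * Y - Y * X = c • 1) (n : ℕ) :
    divPow X (n + 1) * Y - Y * divPow X (n + 1) = c • divPow X n := by
  induction n with
  | zero => simpa [divPow_zero, divPow_one] using h
  | succ n ih =>
    have hn : ((n + 1 : ℕ) : ℝ) + 1 ≠ 0 := by positivity
    apply smul_right_injective R hn
    simp only
    rw [smul_sub, ← smul_mul_assoc, ← mul_smul_comm, succ_smul_divPow_succ]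
    have h1 : X * divPow X (n + 1) * Y - Y * (X * divPow X (n + 1)) =
        X * (divPow X (n + 1) * Y - Y * divPow X (n + 1)) +
          (X * Y - Y * X) * divPow X (n + 1) := by noncomm_ring
    rw [h1, ih, h, mul_smul_comm, ← succ_smul_divPow_succ, smul_mul_assoc, one_mul, smul_smul,
      smul_smul, ← add_smul]
    congr 1
    push_cast
    ring

/-- The coefficients of the identity `exp (t X) exp (t Y) = exp (c t² / 2) exp (t (X + Y))` for
`[X, Y] = c`. -/
theorem sum_divPow_mul_divPow {X Y : R} {c : ℝ} (h : X * Y - Y * X = c • 1) (n : ℕ) :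
    ∑ p ∈ antidiagonal n, divPow X p.1 * divPow Y p.2 =
      ∑ p ∈ antidiagonal n, gaussCoeff c p.1 • divPow (X + Y) p.2 := by
  -- Both generating functions solve F' = (X + Y)F + ctF with F(0) = 1. The factor t links
  -- coefficient n + 2 to coefficient n, hence the two-step induction.
  induction n using Nat.twoStepInduction with
  | zero => simp [divPow_zero, gaussCoeff]
  | one => simp [Nat.sum_antidiagonal_succ, divPow_zero, divPow_one, gaussCoeff, add_comm]
  | more n ih0 ih1 =>
    have hn : ((n + 1 : ℕ) : ℝ) + 1 ≠ 0 := by positivity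
    apply smul_right_injective R hn
    simp only
    rw [succ_smul_sum_antidiagonal, succ_smul_sum_antidiagonal]
    -- Differentiating exp(tX) exp(tY) puts Y between the two factors; moving it to the front costs
    -- the commutator [exp(tX), Y].
    have hL : ∀ p ∈ antidiagonal (n + 1),
        ((p.1 : ℝ) + 1) • (divPow X (p.1 + 1) * divPow Y p.2) +
          ((p.2 : ℝ) + 1) • (divPow X p.1 * divPow Y (p.2 + 1)) =
        (X + Y) * (divPow X p.1 * divPow Y p.2) +
          (divPow X p.1 * Y - Y * divPow X p.1) * divPow Y p.2 := by
      intro p _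
      rw [← smul_mul_assoc, ← mul_smul_comm, succ_smul_divPow_succ, succ_smul_divPow_succ]
      noncomm_ring
    have hR : ∀ p ∈ antidiagonal (n + 1),
        ((p.1 : ℝ) + 1) • (gaussCoeff c (p.1 + 1) • divPow (X + Y) p.2) +
          ((p.2 : ℝ) + 1) • (gaussCoeff c p.1 • divPow (X + Y) (p.2 + 1)) =
        (X + Y) * (gaussCoeff c p.1 • divPow (X + Y) p.2) +
          (((p.1 : ℝ) + 1) * gaussCoeff c (p.1 + 1)) • divPow (X + Y) p.2 := by
      intro p _
      rw [smul_comm _ (gaussCoeff c p.1), succ_smul_divPow_succ, mul_smul_comm, smul_smul,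
        add_comm]
    rw [sum_congr rfl hL, sum_congr rfl hR, sum_add_distrib, sum_add_distrib, ← mul_sum,
      ← mul_sum, ih1]
    congr 1
    rw [Nat.sum_antidiagonal_succ, Nat.sum_antidiagonal_succ]
    have hL' : ∀ p ∈ antidiagonal n,
        (divPow X (p.1 + 1) * Y - Y * divPow X (p.1 + 1)) * divPow Y p.2 =
          c • (divPow X p.1 * divPow Y p.2) := by
      intro p _
      rw [divPow_succ_mul_sub h, smul_mul_assoc]
    refine congrArg₂ (· + ·) (by simp [divPow_zero, gaussCoeff]) ?_
    rw [sum_congr rfl hL', ← smul_sum, ih0, smul_sum]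
    refine sum_congr rfl fun p _ => ?_
    rw [gaussCoeff, smul_smul]
    congr 1
    have : (p.1 : ℝ) + 2 ≠ 0 := by positivity
    push_cast
    field_simp
    ring

end Algebra

/-! ### Ladder operators on finitely supported sequences, and their growth. -/

section FiniteVectors

theorem real_smul_eq_op_smul (r : ℝ) (w : ℕ →₀ ℍ) : r • w = w <• (r : ℍ) := by
  ext1 k
  rw [Finsupp.smul_apply, Finsupp.smul_apply, op_smul_eq_mul, Quaternion.mul_coe_eq_smul]

theorem single_eq_op_smul (m : ℕ) (x : ℍ) :
    Finsupp.single m x = Finsupp.single m (1 : ℍ) <• x := by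
  rw [Finsupp.smul_single, op_smul_eq_mul, one_mul]

theorem finsupp_induction {P : (ℕ →₀ ℍ) → Prop} (hadd : ∀ v w, P v → P w → P (v + w))
    (hsmul : ∀ (b : ℍᵐᵒᵖ) w, P w → P (b • w)) (hsingle : ∀ m, P (Finsupp.single m 1)) (w) :
    P w := by
  induction w using Finsupp.induction_linear with
  | zero => simpa using hsmul 0 _ (hsingle 0)
  | add v w hv hw => exact hadd v w hv hw
  | single m x =>
    rw [single_eq_op_smul]
    exact hsmul _ _ (hsingle m)

theorem finsupp_hom_ext {M : Type*} [AddCommGroup M] [Module ℍᵐᵒᵖ M] {S T : (ℕ →₀ ℍ) →ₗ[ℍᵐᵒᵖ] M}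
    (h : ∀ m, S (Finsupp.single m 1) = T (Finsupp.single m 1)) : S = T := by
  refine LinearMap.ext fun w => ?_
  refine finsupp_induction (P := fun w => S w = T w) (fun v w hv hw => ?_)
    (fun b w hw => ?_) h w
  · rw [map_add, map_add, hv, hw]
  · rw [map_smul, map_smul, hw]

/-- Left multiplication by `q` on finite vectors. -/
noncomputable def finLeft (q : ℍ) : Module.End ℍᵐᵒᵖ (ℕ →₀ ℍ) :=
  Finsupp.mapRange.linearMap (LinearMap.mulLeft ℍᵐᵒᵖ q)

/-- The shift `eₘ ↦ √(m+1) eₘ₊₁` on finite vectors. -/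
noncomputable def finUp : Module.End ℍᵐᵒᵖ (ℕ →₀ ℍ) :=
  Finsupp.lsum ℕ fun m => Real.sqrt (m + 1) • Finsupp.lsingle (m + 1)

/-- The shift `eₘ ↦ √m eₘ₋₁` on finite vectors. -/
noncomputable def finDown : Module.End ℍᵐᵒᵖ (ℕ →₀ ℍ) :=
  Finsupp.lsum ℕ fun m => Real.sqrt m • Finsupp.lsingle (m - 1)

theorem finLeft_single (q : ℍ) (m : ℕ) (x : ℍ) :
    finLeft q (Finsupp.single m x) = Finsupp.single m (q * x) := by
  simp [finLeft]

theorem finUp_single (m : ℕ) (x : ℍ) :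
    finUp (Finsupp.single m x) = Finsupp.single (m + 1) (Real.sqrt (m + 1) • x) := by
  simp [finUp]

theorem finDown_single (m : ℕ) (x : ℍ) :
    finDown (Finsupp.single m x) = Finsupp.single (m - 1) (Real.sqrt m • x) := by
  simp [finDown]

/-- The operator `p · a† + r · a` on finite vectors. -/
noncomputable def ladder (p r : ℍ) : Module.End ℍᵐᵒᵖ (ℕ →₀ ℍ) :=
  finLeft p * finUp + finLeft r * finDown

theorem ladder_single (p r : ℍ) (m : ℕ) (x : ℍ) : ladder p r (Finsupp.single m x) =
    Finsupp.single (m + 1) (Real.sqrt (m + 1) • (p * x)) +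
      Finsupp.single (m - 1) (Real.sqrt m • (r * x)) := by
  simp only [ladder, LinearMap.add_apply, Module.End.mul_apply, finUp_single, finDown_single,
    finLeft_single, mul_smul_comm]

theorem ladder_add (p r p' r' : ℍ) : ladder p r + ladder p' r' = ladder (p + p') (r + r') := by
  refine finsupp_hom_ext fun m => ?_
  simp only [LinearMap.add_apply, ladder_single, add_mul, smul_add, Finsupp.single_add]
  abel

theorem ladder_zero : ladder 0 0 = 0 :=
  finsupp_hom_ext fun m => by simp [ladder_single]

theorem ladder_neg (p r : ℍ) : -ladder p r = ladder (-p) (-r) := by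
  refine finsupp_hom_ext fun m => ?_
  simp only [LinearMap.neg_apply, ladder_single, neg_mul, smul_neg, Finsupp.single_neg]
  abel

theorem ladder_mul_finLeft (p r q : ℍ) : ladder p r * finLeft q = ladder (p * q) (r * q) := by
  refine finsupp_hom_ext fun m => ?_
  simp only [Module.End.mul_apply, ladder_single, finLeft_single, mul_assoc]

theorem finLeft_mul_ladder (q p r : ℍ) : finLeft q * ladder p r = ladder (q * p) (q * r) := by
  refine finsupp_hom_ext fun m => ?_
  simp only [Module.End.mul_apply, ladder_single, finLeft_single, map_add, mul_assoc,
    mul_smul_comm]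

theorem ladder_commutator {p r : ℍ} {c : ℝ} (h : p * r = c) (h' : r * p = c) :
    ladder p 0 * ladder 0 r - ladder 0 r * ladder p 0 = (-c) • 1 := by
  refine finsupp_hom_ext fun m => ?_
  have hm : Real.sqrt (m : ℝ) * Real.sqrt m = m := Real.mul_self_sqrt (by positivity)
  have hm1 : Real.sqrt ((m : ℝ) + 1) * Real.sqrt (m + 1) = m + 1 :=
    Real.mul_self_sqrt (by positivity)
  have h1 : (ladder p 0 * ladder 0 r) (Finsupp.single m 1) = Finsupp.single m ((m * c : ℝ) : ℍ) := by
    -- At m = 0 the truncated index m - 1 is 0 rather than -1, and raising it would not return to m;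
    -- the coefficient √0 removes the term.
    rcases m with _ | m
    · simp [ladder_single]
    · simp only [Module.End.mul_apply, ladder_single, zero_mul, smul_zero, Finsupp.single_zero,
        zero_add, add_zero, mul_one, Nat.add_sub_cancel, mul_smul_comm, h, smul_smul]
      rw [Nat.cast_succ] at hm ⊢
      rw [hm, Quaternion.coe_mul, Quaternion.coe_mul_eq_smul]
  have h2 : (ladder 0 r * ladder p 0) (Finsupp.single m 1) =
      Finsupp.single m (((m + 1) * c : ℝ) : ℍ) := by
    simp only [Module.End.mul_apply, ladder_single, zero_mul, smul_zero, Finsupp.single_zero,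
      zero_add, add_zero, mul_one, Nat.add_sub_cancel, mul_smul_comm, h', smul_smul]
    rw [Nat.cast_succ, hm1, Quaternion.coe_mul, Quaternion.coe_mul_eq_smul]
  rw [LinearMap.sub_apply, h1, h2, LinearMap.smul_apply, Module.End.one_apply, ← Finsupp.single_sub,
    ← Quaternion.coe_sub, Finsupp.smul_single]
  congr 1
  rw [← Quaternion.coe_mul_eq_smul, mul_one]
  congr 1
  ring

/-- The `ℓ¹` norm of a finite vector. -/
noncomputable def ellOne (w : ℕ →₀ ℍ) : ℝ := w.sum fun _ x => ‖x‖

theorem ellOne_single (m : ℕ) (x : ℍ) : ellOne (Finsupp.single m x) = ‖x‖ := by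
  simp [ellOne]

theorem ellOne_zero : ellOne 0 = 0 := by simp [ellOne]

theorem ellOne_add_le (v w : ℕ →₀ ℍ) : ellOne (v + w) ≤ ellOne v + ellOne w := by
  classical
  have h : ∀ u : ℕ →₀ ℍ, u.support ⊆ v.support ∪ w.support →
      ellOne u = ∑ k ∈ v.support ∪ w.support, ‖u k‖ :=
    fun u hu => Finsupp.sum_of_support_subset u hu _ fun _ _ => norm_zero
  rw [h _ Finsupp.support_add, h _ Finset.subset_union_left, h _ Finset.subset_union_right,
    ← Finset.sum_add_distrib]
  exact Finset.sum_le_sum fun k _ => norm_add_le _ _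

theorem ellOne_smul (r : ℝ) (w : ℕ →₀ ℍ) : ellOne (r • w) = |r| * ellOne w := by
  rw [ellOne, Finsupp.sum_smul_index' fun _ => norm_zero, ellOne, Finsupp.mul_sum]
  simp [norm_smul]

/-- `w` is supported in `{0, …, n}` and has `ℓ¹` norm at most `κ`. -/
def LevelBound (n : ℕ) (κ : ℝ) (w : ℕ →₀ ℍ) : Prop :=
  (∀ k ∈ w.support, k ≤ n) ∧ ellOne w ≤ κ

theorem exists_levelBound (w : ℕ →₀ ℍ) : ∃ n, LevelBound n (ellOne w) w :=
  ⟨w.support.sup id, fun _ hk => Finset.le_sup (f := id) hk, le_rfl⟩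

/-- Each shift moves the level by at most one and multiplies by at most √(n+1) on levels up to n. -/
theorem LevelBound.ladder {n : ℕ} {κ M : ℝ} {w : ℕ →₀ ℍ} (hw : LevelBound n κ w) {p r : ℍ}
    (hM : ‖p‖ + ‖r‖ ≤ M) : LevelBound (n + 1) (M * Real.sqrt (n + 1) * κ) (ladder p r w) := by
  classical
  have hsum : QuatFock.ladder p r w = ∑ k ∈ w.support,
      (Finsupp.single (k + 1) (Real.sqrt (k + 1) • (p * w k)) +
        Finsupp.single (k - 1) (Real.sqrt k • (r * w k))) := by
    conv_lhs => rw [← w.sum_single, Finsupp.sum, map_sum]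
    exact Finset.sum_congr rfl fun k _ => ladder_single p r k (w k)
  constructor
  · intro j hj
    rw [hsum] at hj
    obtain ⟨k, hk, hjk⟩ := Finset.mem_biUnion.1 (Finsupp.support_finsetSum hj)
    have hkn := hw.1 k hk
    rcases Finset.mem_union.1 (Finsupp.support_add hjk) with h | h
    · have := Finset.mem_singleton.1 (Finsupp.support_single_subset h)
      omega
    · have := Finset.mem_singleton.1 (Finsupp.support_single_subset h)
      omega
  · have hM0 : 0 ≤ M := le_trans (by positivity) hM
    calc ellOne (QuatFock.ladder p r w) ≤ ∑ k ∈ w.support, M * Real.sqrt (n + 1) * ‖w k‖ := by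
          rw [hsum]
          refine (Finset.le_sum_of_subadditive ellOne ellOne_zero.le ellOne_add_le _ _).trans ?_
          refine Finset.sum_le_sum fun k hk => (ellOne_add_le _ _).trans ?_
          have hkn : (k : ℝ) ≤ n := by exact_mod_cast hw.1 k hk
          rw [ellOne_single, ellOne_single, norm_smul, norm_smul, norm_mul, norm_mul,
            Real.norm_of_nonneg (Real.sqrt_nonneg _), Real.norm_of_nonneg (Real.sqrt_nonneg _)]
          have h1 : Real.sqrt (k + 1) ≤ Real.sqrt (n + 1) := Real.sqrt_le_sqrt (by linarith)
          have h2 : Real.sqrt k ≤ Real.sqrt (n + 1) := Real.sqrt_le_sqrt (by linarith)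
          calc _ ≤ Real.sqrt (n + 1) * (‖p‖ * ‖w k‖) + Real.sqrt (n + 1) * (‖r‖ * ‖w k‖) := by
                gcongr
            _ = (‖p‖ + ‖r‖) * (Real.sqrt (n + 1) * ‖w k‖) := by ring
            _ ≤ M * (Real.sqrt (n + 1) * ‖w k‖) := by gcongr
            _ = _ := by ring
      _ = M * Real.sqrt (n + 1) * ellOne w := by rw [← Finset.mul_sum]; rfl
      _ ≤ _ := by gcongr; exact hw.2

/-- The growth `√((n+1)(n+2)⋯(n+j))` of products of `j` ladder operators at level `n`. -/
noncomputable def ladderGrowth (n j : ℕ) : ℝ := Real.sqrt ((n + 1).ascFactorial j)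

theorem ladderGrowth_succ (n j : ℕ) :
    ladderGrowth n (j + 1) = Real.sqrt (n + j + 1) * ladderGrowth n j := by
  rw [ladderGrowth, ladderGrowth, ← Real.sqrt_mul (by positivity), Nat.ascFactorial_succ]
  congr 1
  push_cast
  ring

theorem ladderGrowth_add (n j k : ℕ) :
    ladderGrowth (n + j) k * ladderGrowth n j = ladderGrowth n (j + k) := by
  induction k with
  | zero => simp [ladderGrowth]
  | succ k ih =>
    rw [ladderGrowth_succ, mul_assoc, ih, ← add_assoc, ladderGrowth_succ]
    push_cast
    rw [add_assoc (n : ℝ)]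

theorem LevelBound.ladder_pow {n : ℕ} {κ M : ℝ} {w : ℕ →₀ ℍ} (hw : LevelBound n κ w) {p r : ℍ}
    (hM : ‖p‖ + ‖r‖ ≤ M) (j : ℕ) :
    LevelBound (n + j) (M ^ j * ladderGrowth n j * κ) ((QuatFock.ladder p r ^ j) w) := by
  induction j with
  | zero => simpa [ladderGrowth] using hw
  | succ j ih =>
    have h := ih.ladder hM
    rw [← add_assoc, pow_succ' (QuatFock.ladder p r), Module.End.mul_apply]
    convert h using 1
    rw [ladderGrowth_succ]
    push_cast
    ring

theorem summable_ladderGrowth (M : ℝ) (n : ℕ) :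
    Summable fun j : ℕ => (j.factorial : ℝ)⁻¹ * (M ^ j * ladderGrowth n j) := by
  -- The ratio test needs nonzero terms. For M ≠ 0 the bound n + j + 1 ≤ (n+1)(j+1) makes the ratio
  -- O(1/√(j+1)).
  by_cases hM : M = 0
  · refine summable_of_ne_finset_zero (s := {0}) fun j hj => ?_
    simp [hM, show j ≠ 0 by simpa using hj]
  have hpos : ∀ j, 0 < ladderGrowth n j := fun j =>
    Real.sqrt_pos.2 (by exact_mod_cast Nat.ascFactorial_pos _ _)
  refine summable_of_ratio_test_tendsto_lt_one zero_lt_one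
    (Filter.Eventually.of_forall fun j => ?_) (l := 0) ?_
  · have := hpos j
    positivity
  · have h1 : Filter.Tendsto (fun j : ℕ => |M| * Real.sqrt (n + 1) / Real.sqrt ((j + 1 : ℕ) : ℝ))
        Filter.atTop (nhds 0) :=
      ((Real.tendsto_sqrt_atTop.comp tendsto_natCast_atTop_atTop).comp
        (Filter.tendsto_add_atTop_nat 1)).const_div_atTop _
    refine squeeze_zero (fun j => by positivity) (fun j => ?_) h1
    have hj : (0 : ℝ) < ladderGrowth n j := hpos j
    have hf : (0 : ℝ) < j.factorial := by positivity
    have hMj : 0 < |M| := abs_pos.2 hM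
    have hs : Real.sqrt (n + j + 1) ≤ Real.sqrt (n + 1) * Real.sqrt (j + 1) := by
      rw [← Real.sqrt_mul (by positivity)]
      refine Real.sqrt_le_sqrt ?_
      have : (0 : ℝ) ≤ (n : ℝ) * j := by positivity
      linarith
    have hq : Real.sqrt ((j : ℝ) + 1) * Real.sqrt (j + 1) = j + 1 :=
      Real.mul_self_sqrt (by positivity)
    have hr : 0 < Real.sqrt ((j : ℝ) + 1) := Real.sqrt_pos.2 (by positivity)
    simp only [norm_mul, norm_inv, norm_pow, Real.norm_eq_abs, ladderGrowth_succ,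
      Nat.factorial_succ, Nat.cast_mul, Nat.cast_succ, abs_of_pos hj, abs_of_pos hf,
      abs_of_nonneg (Real.sqrt_nonneg _), pow_succ]
    rw [abs_of_pos (by positivity : (0 : ℝ) < (j : ℝ) + 1)]
    calc _ = |M| * Real.sqrt (n + j + 1) / (j + 1) := by field_simp
      _ ≤ |M| * (Real.sqrt (n + 1) * Real.sqrt (j + 1)) / (j + 1) := by gcongr
      _ = _ := by
        rw [div_eq_div_iff (by positivity) hr.ne']
        linear_combination |M| * Real.sqrt (n + 1) * hq

/-- On the antidiagonal j + k = N the weights 1/(j! k!) add up to 2^N/N!, which reduces the double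
series to the single one with 2M in place of M. -/
theorem summable_prod_ladderGrowth (M : ℝ) (hM : 0 ≤ M) (n : ℕ) : Summable fun p : ℕ × ℕ =>
    ((p.1.factorial : ℝ)⁻¹ * (p.2.factorial : ℝ)⁻¹) *
      (M ^ (p.1 + p.2) * ladderGrowth n (p.1 + p.2)) := by
  have hg : ∀ j, 0 ≤ ladderGrowth n j := fun j => Real.sqrt_nonneg _
  rw [← Finset.HasAntidiagonal.sigmaAntidiagonalEquivProd.summable_iff,
    summable_sigma_of_nonneg]
  · refine ⟨fun _ => Summable.of_finite, (summable_ladderGrowth (2 * M) n).congr fun N => ?_⟩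
    refine Eq.trans ?_ (tsum_fintype _).symm
    simp only [Function.comp, Finset.HasAntidiagonal.sigmaAntidiagonalEquivProd_apply]
    rw [Finset.sum_coe_sort (Finset.HasAntidiagonal.antidiagonal N) fun p : ℕ × ℕ =>
      ((p.1.factorial : ℝ)⁻¹ * (p.2.factorial : ℝ)⁻¹) *
      (M ^ (p.1 + p.2) * ladderGrowth n (p.1 + p.2))]
    have h : ∀ p ∈ Finset.HasAntidiagonal.antidiagonal N, ((p.1.factorial : ℝ)⁻¹ * (p.2.factorial : ℝ)⁻¹) *
        (M ^ (p.1 + p.2) * ladderGrowth n (p.1 + p.2)) =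
        ((N.factorial : ℝ)⁻¹ * (M ^ N * ladderGrowth n N)) * (N.choose p.1 : ℝ) := by
      intro p hp
      obtain rfl := Finset.HasAntidiagonal.mem_antidiagonal.1 hp
      rw [Nat.choose_symm_add, Nat.add_choose, Nat.cast_div (Nat.factorial_mul_factorial_dvd_factorial_add _ _)
        (by positivity)]
      push_cast
      field_simp
    rw [Finset.sum_congr rfl h, ← Finset.mul_sum, ← Nat.cast_sum,
      Finset.Nat.sum_antidiagonal_eq_sum_range_succ (fun i _ => N.choose i),
      Nat.sum_range_choose, mul_pow]
    push_cast
    ring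
  · intro x
    have := hg ((Finset.HasAntidiagonal.sigmaAntidiagonalEquivProd x).1 +
      (Finset.HasAntidiagonal.sigmaAntidiagonalEquivProd x).2)
    simp only [Function.comp]
    positivity

end FiniteVectors

/-! ### Cauchy–Schwarz and continuity of the quaternionic inner product. -/

section InnerProduct

variable {H : Type*} [NormedAddCommGroup H] [Module ℍᵐᵒᵖ H] [RightQuatInnerSpace H]

theorem qinner_add_left (f g h : H) : qinner (f + g) h = qinner f h + qinner g h := by
  rw [← star_qinner, qinner_add, star_add, star_qinner, star_qinner]

theorem norm_qinner_le (f g : H) : ‖qinner f g‖ ≤ ‖f‖ * ‖g‖ := by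
  rcases eq_or_ne f 0 with rfl | hf
  · rw [← star_qinner, qinner_zero]
    simp
  have hf' : 0 < ‖f‖ := norm_pos_iff.2 hf
  set z := qinner f g with hz
  set s : ℝ := (‖f‖ ^ 2)⁻¹ with hs
  -- The vector f·(z s) is the orthogonal projection of g onto f; the squared norm of the remainder
  -- is nonnegative.
  have h := qinner_self (g - f <• (z * (s : ℍ)))
  have hsub : ∀ a b c : H, qinner (a - b) c = qinner a c - qinner b c := fun a b c => by
    rw [← star_qinner, qinner_sub, star_sub, star_qinner, star_qinner]
  have h1 : qinner g (f <• (z * (s : ℍ))) = ((‖z‖ ^ 2 * s : ℝ) : ℍ) := by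
    rw [qinner_smul, ← star_qinner, ← hz, ← mul_assoc, star_mul_self_eq, ← Quaternion.coe_mul]
  have h2 : qinner (f <• (z * (s : ℍ))) g = ((‖z‖ ^ 2 * s : ℝ) : ℍ) := by
    rw [← star_qinner, h1, Quaternion.star_coe]
  have h3 : ‖f <• (z * (s : ℍ))‖ ^ 2 = ‖z‖ ^ 2 * s := by
    rw [norm_smul_right, norm_mul, Quaternion.norm_coe, Real.norm_of_nonneg (by positivity), hs]
    field_simp
  rw [hsub, qinner_sub, qinner_sub, h1, h2, qinner_self, qinner_self, h3, ← Quaternion.coe_sub,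
    ← Quaternion.coe_sub, ← Quaternion.coe_sub, Quaternion.coe_inj] at h
  have h4 : ‖z‖ ^ 2 * s ≤ ‖g‖ ^ 2 := by
    have := sq_nonneg ‖g - f <• (z * (s : ℍ))‖
    linarith
  rw [hs, ← div_eq_mul_inv, div_le_iff₀ (by positivity)] at h4
  refine le_of_sq_le_sq ?_ (by positivity)
  linarith [mul_pow ‖f‖ ‖g‖ 2]

/-- The additive map `⟨f | ·⟩`. -/
def qinnerHom (f : H) : H →+ ℍ where
  toFun := qinner f
  map_zero' := qinner_zero f
  map_add' := qinner_add f

/-- The additive map `⟨· | g⟩`. -/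
def qinnerHomLeft (g : H) : H →+ ℍ where
  toFun f := qinner f g
  map_zero' := by rw [← star_qinner, qinner_zero, star_zero]
  map_add' f f' := qinner_add_left f f' g

/-- The additive map `r ↦ φ r` on the reals. -/
noncomputable def realSMulHom (φ : H) : ℝ →+ H where
  toFun r := φ <• (r : ℍ)
  map_zero' := by simp
  map_add' r s := by rw [Quaternion.coe_add, MulOpposite.op_add, add_smul]

theorem continuous_qinner_right (f : H) : Continuous fun g : H => qinner f g :=
  AddMonoidHomClass.continuous_of_bound (qinnerHom f) ‖f‖ (norm_qinner_le f)

theorem continuous_qinner_left (g : H) : Continuous fun f : H => qinner f g :=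
  AddMonoidHomClass.continuous_of_bound (qinnerHomLeft g) ‖g‖ fun f =>
    (norm_qinner_le f g).trans_eq (mul_comm _ _)

theorem continuous_realSMul (φ : H) : Continuous fun r : ℝ => φ <• (r : ℍ) :=
  AddMonoidHomClass.continuous_of_bound (realSMulHom φ) ‖φ‖ fun r =>
    (norm_smul_right φ _).trans_le (by rw [Quaternion.norm_coe])

theorem hasSum_qinner_right {ι : Type*} (f : H) {u : ι → H} {ψ : H} (h : HasSum u ψ) :
    HasSum (fun i => qinner f (u i)) (qinner f ψ) :=
  h.map (qinnerHom f) (continuous_qinner_right f)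

theorem hasSum_qinner_left {ι : Type*} (g : H) {u : ι → H} {ψ : H} (h : HasSum u ψ) :
    HasSum (fun i => qinner (u i) g) (qinner ψ g) :=
  h.map (qinnerHomLeft g) (continuous_qinner_left g)

theorem hasSum_realSMul {ι : Type*} (φ : H) {r : ι → ℝ} {s : ℝ} (h : HasSum r s) :
    HasSum (fun i => φ <• (r i : ℍ)) (φ <• (s : ℍ)) :=
  h.map (realSMulHom φ) (continuous_realSMul φ)

theorem qinner_realSMul_left (f g : H) (r : ℝ) :
    qinner (f <• (r : ℍ)) g = qinner f (g <• (r : ℍ)) := by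
  rw [qinner_smul_left, qinner_smul, Quaternion.star_coe, Quaternion.coe_commutes]

end InnerProduct

/-! ### Finite vectors as a dense subspace of the Hilbert space. -/

section Synthesis

variable {H : Type*} [NormedAddCommGroup H] [Module ℍᵐᵒᵖ H] [RightQuatInnerSpace H]
  (e : QuatHilbertBasis H)

/-- The vector `∑ₖ eₖ wₖ`. -/
noncomputable def synth : (ℕ →₀ ℍ) →ₗ[ℍᵐᵒᵖ] H :=
  Finsupp.lsum ℕ fun k =>
    { toFun := fun x => e.vec k <• x
      map_add' := fun x y => by rw [MulOpposite.op_add, add_smul]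
      map_smul' := fun b x => by
        rw [RingHom.id_apply, smul_smul]
        rfl }

theorem synth_single (k : ℕ) (x : ℍ) : synth e (Finsupp.single k x) = e.vec k <• x := by
  simp [synth]

theorem synth_single_one (k : ℕ) : synth e (Finsupp.single k 1) = e.vec k := by
  rw [synth_single, MulOpposite.op_one, one_smul]

theorem synth_real_smul (r : ℝ) (w : ℕ →₀ ℍ) : synth e (r • w) = synth e w <• (r : ℍ) := by
  rw [real_smul_eq_op_smul, map_smul]

theorem norm_vec (k : ℕ) : ‖e.vec k‖ = 1 := by
  have h := qinner_self (e.vec k)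
  rw [e.orthonormal, if_pos rfl, ← Quaternion.coe_one, Quaternion.coe_inj] at h
  exact (pow_eq_one_iff_of_nonneg (norm_nonneg _) two_ne_zero).1 h.symm

theorem norm_synth_le (w : ℕ →₀ ℍ) : ‖synth e w‖ ≤ ellOne w := by
  conv_lhs => rw [← w.sum_single, Finsupp.sum, map_sum]
  refine norm_sum_le_of_le _ fun k _ => ?_
  rw [synth_single, norm_smul_right, norm_vec, one_mul]

theorem range_synth : LinearMap.range (synth e) = Submodule.span ℍᵐᵒᵖ (Set.range e.vec) := by
  refine le_antisymm ?_ (Submodule.span_le.2 ?_)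
  · rintro _ ⟨w, rfl⟩
    refine finsupp_induction (P := fun w => synth e w ∈ Submodule.span ℍᵐᵒᵖ (Set.range e.vec))
      (fun v w hv hw => ?_) (fun b w hw => ?_) (fun m => ?_) w
    · rw [map_add]; exact Submodule.add_mem _ hv hw
    · rw [map_smul]; exact Submodule.smul_mem _ _ hw
    · rw [synth_single_one]; exact Submodule.subset_span ⟨m, rfl⟩
  · rintro _ ⟨k, rfl⟩
    exact ⟨_, synth_single_one e k⟩

theorem denseRange_synth : DenseRange (synth e) := by
  have h := e.dense_span
  rw [← range_synth] at h
  exact h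

theorem eq_of_qinner_synth_eq {φ ψ : H}
    (h : ∀ w, qinner (synth e w) φ = qinner (synth e w) ψ) : φ = ψ := by
  have hcont := (denseRange_synth e).equalizer (continuous_qinner_left φ)
    (continuous_qinner_left ψ) (funext h)
  have h1 := congrFun hcont (φ - ψ)
  have h2 : qinner (φ - ψ) (φ - ψ) = 0 := by rw [qinner_sub, h1, sub_self]
  rw [qinner_self, ← Quaternion.coe_zero, Quaternion.coe_inj] at h2
  exact sub_eq_zero.1 (norm_eq_zero.1 (pow_eq_zero_iff two_ne_zero |>.1 h2))

/-- A relation between left pairings is determined by the basis vectors. -/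
theorem qinner_synth_eq_of_single {S : Module.End ℍᵐᵒᵖ (ℕ →₀ ℍ)} {φ ψ : H}
    (h : ∀ m, qinner (e.vec m) ψ = qinner (synth e (S (Finsupp.single m 1))) φ) (w : ℕ →₀ ℍ) :
    qinner (synth e w) ψ = qinner (synth e (S w)) φ := by
  refine finsupp_induction (P := fun w => qinner (synth e w) ψ = qinner (synth e (S w)) φ)
    (fun v w hv hw => ?_) (fun b w hw => ?_) (fun m => ?_) w
  · rw [map_add, map_add, map_add, qinner_add_left, qinner_add_left, hv, hw]
  · have hb : ∀ f g : H, qinner (b • f) g = star b.unop * qinner f g := fun f g => by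
      simpa using qinner_smul_left f g b.unop
    rw [map_smul, map_smul, map_smul, hb, hb, hw]
  · rw [synth_single_one]; exact h m

end Synthesis

/-! ### Unbounded operators trapped between a ladder operator and an adjoint. -/

section Representation

variable {H : Type*} [NormedAddCommGroup H] [Module ℍᵐᵒᵖ H] [RightQuatInnerSpace H]
  (e : QuatHilbertBasis H)

/-- The unbounded operator `T` extends `p · a† + r · a` on finite vectors and is contained in the
adjoint of `r̄ · a† + p̄ · a` on finite vectors. -/
structure Represents (T : H →ₗ.[ℍᵐᵒᵖ] H) (p r : ℍ) : Prop where
  mem_graph : ∀ w, (synth e w, synth e (ladder p r w)) ∈ T.graph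
  qinner_eq : ∀ φ ψ, (φ, ψ) ∈ T.graph → ∀ w,
    qinner (synth e w) ψ = qinner (synth e (ladder (star r) (star p) w)) φ

variable {e}

theorem Represents.of_single {T : H →ₗ.[ℍᵐᵒᵖ] H} {p r : ℍ}
    (h : ∀ m, (e.vec m, synth e (ladder p r (Finsupp.single m 1))) ∈ T.graph)
    (h' : ∀ φ ψ, (φ, ψ) ∈ T.graph → ∀ m, qinner (e.vec m) ψ =
      qinner (synth e (ladder (star r) (star p) (Finsupp.single m 1))) φ) :
    Represents e T p r where
  mem_graph w := by
    refine finsupp_induction (P := fun w => (synth e w, synth e (ladder p r w)) ∈ T.graph)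
      (fun v w hv hw => ?_) (fun b w hw => ?_) (fun m => ?_) w
    · simpa only [map_add, Prod.mk_add_mk] using T.graph.add_mem hv hw
    · simpa only [map_smul, Prod.smul_mk] using T.graph.smul_mem b hw
    · simpa only [synth_single_one] using h m
  qinner_eq φ ψ hφ := qinner_synth_eq_of_single e (h' φ ψ hφ)

theorem Represents.neg {T : H →ₗ.[ℍᵐᵒᵖ] H} {p r : ℍ} (h : Represents e T p r) :
    Represents e (-T) (-p) (-r) where
  mem_graph w := by
    rw [← ladder_neg, LinearMap.neg_apply, map_neg]
    obtain ⟨y, hy1, hy2⟩ := T.mem_graph_iff.1 (h.mem_graph w)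
    refine (-T).mem_graph_iff.2 ⟨y, hy1, ?_⟩
    rw [LinearPMap.neg_apply, hy2]
  qinner_eq φ ψ hφ w := by
    obtain ⟨y, rfl, rfl⟩ := (-T).mem_graph_iff.1 hφ
    have hy := h.qinner_eq _ _ (T.mem_graph y) w
    have hneg : ∀ f g : H, qinner f (-g) = -qinner f g := fun f g => map_neg (qinnerHom f) g
    have hneg' : ∀ f g : H, qinner (-f) g = -qinner f g := fun f g =>
      map_neg (qinnerHomLeft g) f
    rw [star_neg, star_neg, ← ladder_neg, LinearMap.neg_apply, map_neg, hneg', ← hy]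
    exact hneg _ _

theorem Represents.sub {T T' : H →ₗ.[ℍᵐᵒᵖ] H} {p r p' r' : ℍ} (h : Represents e T p r)
    (h' : Represents e T' p' r') : Represents e (T - T') (p - p') (r - r') where
  mem_graph w := by
    obtain ⟨y, hy1, hy2⟩ := T.mem_graph_iff.1 (h.mem_graph w)
    obtain ⟨z, hz1, hz2⟩ := T'.mem_graph_iff.1 (h'.mem_graph w)
    simp only at hy1 hy2 hz1 hz2
    refine (T - T').mem_graph_iff.2
      ⟨⟨synth e w, by rw [← hy1]; exact y.2, by rw [← hz1]; exact z.2⟩, rfl, ?_⟩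
    rw [LinearPMap.sub_apply, sub_eq_add_neg p, sub_eq_add_neg r, ← ladder_add, ← ladder_neg,
      LinearMap.add_apply, LinearMap.neg_apply, map_add, map_neg, ← sub_eq_add_neg]
    rw [← hy2, ← hz2]
    congr 2 <;> exact Subtype.ext (by simp [hy1, hz1])
  qinner_eq φ ψ hφ w := by
    obtain ⟨y, rfl, rfl⟩ := (T - T').mem_graph_iff.1 hφ
    have hy := h.qinner_eq _ _ (T.mem_graph ⟨y, y.2.1⟩) w
    have hz := h'.qinner_eq _ _ (T'.mem_graph ⟨y, y.2.2⟩) w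
    have hsub' : ∀ f f' g : H, qinner (f - f') g = qinner f g - qinner f' g := fun f f' g =>
      map_sub (qinnerHomLeft g) f f'
    rw [LinearPMap.sub_apply, qinner_sub, star_sub, star_sub, sub_eq_add_neg (star r),
      sub_eq_add_neg (star p), ← ladder_add, ← ladder_neg, LinearMap.add_apply,
      LinearMap.neg_apply, map_add, map_neg, ← sub_eq_add_neg, hsub']
    exact congrArg₂ _ hy hz

theorem leftMul_vec_smul [CompleteSpace H] (q : ℍ) (m : ℕ) (x : ℍ) :
    leftMul e q (e.vec m <• x) = e.vec m <• (q * x) := by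
  change ∑' k, e.vec k <• (q * qinner (e.vec k) (e.vec m <• x)) = _
  rw [tsum_eq_single m]
  · rw [qinner_smul, e.orthonormal, if_pos rfl, one_mul]
  · intro k hk
    rw [qinner_smul, e.orthonormal, if_neg hk]
    simp

theorem leftMul_synth [CompleteSpace H] (q : ℍ) (w : ℕ →₀ ℍ) :
    leftMul e q (synth e w) = synth e (finLeft q w) := by
  have h : (leftMul e q).comp (synth e) = (synth e).comp (finLeft q) := finsupp_hom_ext fun m => by
    rw [LinearMap.comp_apply, LinearMap.comp_apply, synth_single, finLeft_single, synth_single,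
      leftMul_vec_smul]
  exact LinearMap.congr_fun h w

theorem qinner_tsum_vec {x : ℕ → ℍ} {i : ℕ → ℕ} (hi : i.Injective)
    (hx : Summable fun k => e.vec (i k) <• x k) (m : ℕ) :
    qinner (e.vec (i m)) (∑' k, e.vec (i k) <• x k) = x m := by
  have h := hasSum_qinner_right (e.vec (i m)) hx.hasSum
  have h' := hasSum_single (f := fun k => qinner (e.vec (i m)) (e.vec (i k) <• x k)) m
    fun k hk => by rw [qinner_smul, e.orthonormal, if_neg (fun hmk => hk (hi hmk.symm)), zero_mul]
  rw [h.unique h', qinner_smul, e.orthonormal, if_pos rfl, one_mul]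

theorem qinner_leftMul [CompleteSpace H] (q : ℍ) (φ : H) (w : ℕ →₀ ℍ) :
    qinner (synth e w) (leftMul e q φ) = qinner (synth e (finLeft (star q) w)) φ := by
  refine qinner_synth_eq_of_single e (fun m => ?_) w
  rw [finLeft_single, mul_one, synth_single, qinner_smul_left, star_star]
  exact qinner_tsum_vec Function.injective_id (summable_leftMul e q φ) m

/-- Real quaternions are central, so the basis-dependent left action agrees with the right one. This
turns the scalar prefactors of the ordered products into ordinary scalars. -/
theorem leftMul_coe [CompleteSpace H] (r : ℝ) (φ : H) : leftMul e (r : ℍ) φ = φ <• (r : ℍ) := by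
  refine eq_of_qinner_synth_eq e fun w => ?_
  rw [qinner_leftMul, ← qinner_realSMul_left, ← synth_real_smul, Quaternion.star_coe]
  congr 2
  ext1 k
  simp [finLeft, Quaternion.coe_mul_eq_smul]

theorem Represents.leftSMul [CompleteSpace H] {T : H →ₗ.[ℍᵐᵒᵖ] H} {p r : ℍ}
    (h : Represents e T p r) (q : ℍ) : Represents e (leftSMul e q T) (q * p) (q * r) where
  mem_graph w := by
    obtain ⟨y, hy1, hy2⟩ := T.mem_graph_iff.1 (h.mem_graph w)
    refine (QuatFock.leftSMul e q T).mem_graph_iff.2 ⟨y, hy1, ?_⟩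
    rw [← finLeft_mul_ladder, Module.End.mul_apply, ← leftMul_synth]
    exact congrArg (leftMul e q) hy2
  qinner_eq φ ψ hφ w := by
    obtain ⟨y, rfl, rfl⟩ := (QuatFock.leftSMul e q T).mem_graph_iff.1 hφ
    have hy := h.qinner_eq _ _ (T.mem_graph y) (finLeft (star q) w)
    rw [star_mul, star_mul, ← ladder_mul_finLeft, Module.End.mul_apply]
    exact (qinner_leftMul q _ w).trans hy

theorem represents_creation : Represents e (creation e) 1 0 := by
  refine Represents.of_single (fun m => ?_) fun φ ψ hφ m => ?_
  · have h : HasSum (fun k : ℕ => e.vec (k + 1) <•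
        ((Real.sqrt (k + 1) : ℍ) * qinner (e.vec k) (e.vec m)))
        (synth e (ladder 1 0 (Finsupp.single m 1))) := by
      convert hasSum_single m fun k hk => ?_ using 1
      · simp [ladder_single, synth_single, e.orthonormal]
        rw [← MulOpposite.op_one, ← MulOpposite.op_smul, ← Quaternion.coe_mul_eq_smul, mul_one]
      · rw [e.orthonormal, if_neg hk]
        simp
    exact (creation e).mem_graph_iff.2 ⟨⟨e.vec m, h.summable⟩, rfl, h.tsum_eq⟩
  · obtain ⟨y, rfl, rfl⟩ := (creation e).mem_graph_iff.1 hφ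
    -- The range of a† has no e₀ component; on the adjoint side this matches the coefficient √0 of
    -- the lowering shift.
    rcases m with _ | m
    · have h := hasSum_qinner_right (e.vec 0) (Summable.hasSum y.2)
      have h0 : ∀ k : ℕ, qinner (e.vec 0) (e.vec (k + 1) <•
          ((Real.sqrt (k + 1) : ℍ) * qinner (e.vec k) (y : H))) = 0 := fun k => by
        rw [qinner_smul, e.orthonormal, if_neg (by omega), zero_mul]
      simp only [h0] at h
      refine (h.unique hasSum_zero).trans ?_
      simp [ladder_single]
      exact (map_zero (qinnerHomLeft _)).symm
    · refine (qinner_tsum_vec (add_left_injective 1) y.2 m).trans ?_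
      simp [ladder_single, synth_single, qinner_smul_left, ← Quaternion.coe_mul_eq_smul]

theorem represents_annihilation : Represents e (annihilation e) 0 1 := by
  refine Represents.of_single (fun m => ?_) fun φ ψ hφ m => ?_
  · have h : HasSum (fun k : ℕ => e.vec k <•
        ((Real.sqrt (k + 1) : ℍ) * qinner (e.vec (k + 1)) (e.vec m)))
        (synth e (ladder 0 1 (Finsupp.single m 1))) := by
      rcases m with _ | m
      · convert hasSum_zero (α := H) using 1
        · funext k
          rw [e.orthonormal, if_neg (by omega)]
          simp
        · simp [ladder_single]
      convert hasSum_single m fun k hk => ?_ using 1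
      · simp [ladder_single, synth_single, e.orthonormal]
        rw [← MulOpposite.op_one, ← MulOpposite.op_smul, ← Quaternion.coe_mul_eq_smul, mul_one]
      · rw [e.orthonormal, if_neg (by omega)]
        simp
    exact (annihilation e).mem_graph_iff.2 ⟨⟨e.vec m, h.summable⟩, rfl, h.tsum_eq⟩
  · obtain ⟨y, rfl, rfl⟩ := (annihilation e).mem_graph_iff.1 hφ
    refine (qinner_tsum_vec Function.injective_id y.2 m).trans ?_
    simp [ladder_single, synth_single, qinner_smul_left, ← Quaternion.coe_mul_eq_smul]

end Representation

/-! ### Convergence, duality and closability of the exponentials. -/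

section Exponential

variable {H : Type*} [NormedAddCommGroup H] [Module ℍᵐᵒᵖ H] [RightQuatInnerSpace H]
  (e : QuatHilbertBasis H)

theorem synth_divPow (L : Module.End ℍᵐᵒᵖ (ℕ →₀ ℍ)) (n : ℕ) (w : ℕ →₀ ℍ) :
    synth e (divPow L n w) = synth e ((L ^ n) w) <• (((n.factorial : ℝ)⁻¹ : ℝ) : ℍ) := by
  rw [divPow, LinearMap.smul_apply, synth_real_smul]

theorem norm_synth_divPow_mul_le {n : ℕ} {κ M : ℝ} {w : ℕ →₀ ℍ} (hw : LevelBound n κ w)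
    {p r p' r' : ℍ} (hM : ‖p‖ + ‖r‖ ≤ M) (hM' : ‖p'‖ + ‖r'‖ ≤ M) (j k : ℕ) :
    ‖synth e ((divPow (ladder p r) j * divPow (ladder p' r') k) w)‖ ≤
      ((j.factorial : ℝ)⁻¹ * (k.factorial : ℝ)⁻¹) *
        (M ^ (j + k) * ladderGrowth n (j + k)) * κ := by
  have h := ((hw.ladder_pow hM' k).ladder_pow hM j).2
  have hc : 0 ≤ (j.factorial : ℝ)⁻¹ * (k.factorial : ℝ)⁻¹ := by positivity
  refine (norm_synth_le e _).trans ?_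
  rw [divPow, divPow, smul_mul_smul_comm, LinearMap.smul_apply, ellOne_smul, Module.End.mul_apply,
    abs_of_nonneg hc, mul_assoc _ _ κ]
  refine mul_le_mul_of_nonneg_left (h.trans_eq ?_) hc
  rw [add_comm j k, ← ladderGrowth_add, pow_add]
  ring

theorem hasSum_sum_antidiagonal {M : Type*} [NormedAddCommGroup M] {f : ℕ × ℕ → M} {a : M}
    (h : HasSum f a) :
    HasSum (fun n => ∑ p ∈ Finset.HasAntidiagonal.antidiagonal n, f p) a :=
  (Finset.HasAntidiagonal.sigmaAntidiagonalEquivProd.hasSum_iff.2 h).sigma fun n =>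
    Finset.hasSum (Finset.HasAntidiagonal.antidiagonal n) f

theorem summable_norm_synth_divPow (p r : ℍ) (w : ℕ →₀ ℍ) : Summable fun n =>
    ‖synth e (divPow (ladder p r) n w)‖ := by
  obtain ⟨n, hw⟩ := exists_levelBound w
  refine Summable.of_nonneg_of_le (fun _ => norm_nonneg _) (fun j => ?_)
    ((summable_ladderGrowth (‖p‖ + ‖r‖) n).mul_right (ellOne w))
  simpa [divPow_zero] using norm_synth_divPow_mul_le e hw (le_refl (‖p‖ + ‖r‖)) le_rfl j 0

theorem Represents.qinner_pow {e : QuatHilbertBasis H} {T : H →ₗ.[ℍᵐᵒᵖ] H} {p r : ℍ} (h : Represents e T p r) {u : ℕ → H}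
    (hu : ∀ n, (u n, u (n + 1)) ∈ T.graph) (n : ℕ) (w : ℕ →₀ ℍ) :
    qinner (synth e w) (u n) = qinner (synth e ((ladder (star r) (star p) ^ n) w)) (u 0) := by
  induction n generalizing w with
  | zero => simp
  | succ n ih => rw [h.qinner_eq _ _ (hu n), ih, pow_succ, Module.End.mul_apply]

variable [CompleteSpace H]

theorem summable_synth_divPow_mul (p r p' r' : ℍ) (w : ℕ →₀ ℍ) : Summable fun x : ℕ × ℕ =>
    synth e ((divPow (ladder p r) x.1 * divPow (ladder p' r') x.2) w) := by
  obtain ⟨n, hw⟩ := exists_levelBound w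
  have hM : 0 ≤ max (‖p‖ + ‖r‖) (‖p'‖ + ‖r'‖) := le_trans (by positivity) (le_max_left _ _)
  exact Summable.of_norm_bounded ((summable_prod_ladderGrowth _ hM n).mul_right _) fun x =>
    norm_synth_divPow_mul_le e hw (le_max_left _ _) (le_max_right _ _) x.1 x.2

theorem summable_synth_divPow (p r : ℍ) (w : ℕ →₀ ℍ) : Summable fun n =>
    synth e (divPow (ladder p r) n w) :=
  (summable_norm_synth_divPow e p r w).of_norm

/-- The exponential of `p · a† + r · a` on finite vectors. -/
noncomputable def expVec (p r : ℍ) : (ℕ →₀ ℍ) →ₗ[ℍᵐᵒᵖ] H where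
  toFun w := ∑' n, synth e (divPow (ladder p r) n w)
  map_add' v w := by
    rw [← (summable_synth_divPow e p r v).tsum_add (summable_synth_divPow e p r w)]
    simp only [map_add]
  map_smul' b w := by
    rw [RingHom.id_apply, ← (summable_synth_divPow e p r w).tsum_const_smul b]
    simp only [map_smul]

theorem hasSum_expVec (p r : ℍ) (w : ℕ →₀ ℍ) :
    HasSum (fun n => synth e (divPow (ladder p r) n w)) (expVec e p r w) :=
  (summable_synth_divPow e p r w).hasSum

/-- The closure of the graph of the exponential of `p · a† + r · a` on finite vectors. -/
noncomputable def expGraph (p r : ℍ) : Submodule ℍᵐᵒᵖ (H × H) :=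
  (LinearMap.range ((synth e).prod (expVec e p r))).topologicalClosure

theorem expVec_mem_expGraph (p r : ℍ) (w : ℕ →₀ ℍ) :
    (synth e w, expVec e p r w) ∈ expGraph e p r :=
  Submodule.le_topologicalClosure _ ⟨w, rfl⟩

variable {e}

theorem expGraph_le_of_forall {p r : ℍ} {G : Submodule ℍᵐᵒᵖ (H × H)}
    (hG : IsClosed (G : Set (H × H))) (h : ∀ w, (synth e w, expVec e p r w) ∈ G) :
    expGraph e p r ≤ G := by
  refine Submodule.topologicalClosure_minimal _ ?_ hG
  rintro _ ⟨w, rfl⟩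
  exact h w

theorem Represents.mem_expSeriesGraph {T : H →ₗ.[ℍᵐᵒᵖ] H} {p r : ℍ} (h : Represents e T p r)
    (w : ℕ →₀ ℍ) : (synth e w, expVec e p r w) ∈ expSeriesGraph T := by
  refine ⟨fun n => synth e ((ladder p r ^ n) w), by simp, fun n => ?_, ?_⟩
  · simpa only [pow_succ', Module.End.mul_apply] using h.mem_graph ((ladder p r ^ n) w)
  · refine (hasSum_expVec e p r w).congr_fun fun n => ?_
    exact (synth_divPow e _ n w).symm

theorem Represents.expGraph_le {T : H →ₗ.[ℍᵐᵒᵖ] H} {p r : ℍ} (h : Represents e T p r) :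
    expGraph e p r ≤ (expSeriesGraph T).topologicalClosure :=
  expGraph_le_of_forall (Submodule.isClosed_topologicalClosure _) fun w =>
    Submodule.le_topologicalClosure _ (h.mem_expSeriesGraph w)

/-- For a vector in the domain of the series, each power of T moves to the test vector as a power of
the conjugate ladder operator. The resulting identity is a closed condition, so it survives the
closure. -/
theorem Represents.qinner_exp {T : H →ₗ.[ℍᵐᵒᵖ] H} {p r : ℍ} (h : Represents e T p r) {φ ψ : H}
    (hφ : (φ, ψ) ∈ (expSeriesGraph T).topologicalClosure) (w : ℕ →₀ ℍ) :
    qinner (synth e w) ψ = qinner (expVec e (star r) (star p) w) φ := by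
  have hc : IsClosed {x : H × H | qinner (synth e w) x.2 =
      qinner (expVec e (star r) (star p) w) x.1} :=
    isClosed_eq ((continuous_qinner_right _).comp continuous_snd)
      ((continuous_qinner_right _).comp continuous_fst)
  refine closure_minimal ?_ hc hφ
  rintro ⟨φ, ψ⟩ ⟨u, h0, hu, hs⟩
  simp only at h0 hs
  have h1 := hasSum_qinner_right (synth e w) hs
  have h2 := hasSum_qinner_left φ (hasSum_expVec e (star r) (star p) w)
  refine h1.unique (h2.congr_fun fun n => ?_)
  rw [synth_divPow, qinner_realSMul_left, qinner_smul, qinner_smul, h.qinner_pow hu, h0]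

theorem Represents.qinner_eq_of_mem {T : H →ₗ.[ℍᵐᵒᵖ] H} {p r : ℍ} (h : Represents e T p r)
    {φ ψ g g' : H} (hφ : (φ, ψ) ∈ (expSeriesGraph T).topologicalClosure)
    (hg : (g, g') ∈ expGraph e (star r) (star p)) : qinner g ψ = qinner g' φ := by
  have hc : IsClosed {x : H × H | qinner x.1 ψ = qinner x.2 φ} :=
    isClosed_eq ((continuous_qinner_left _).comp continuous_fst)
      ((continuous_qinner_left _).comp continuous_snd)
  refine closure_minimal ?_ hc hg
  rintro _ ⟨w, rfl⟩
  exact h.qinner_exp hφ w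

/-- If (0, ψ) lies in the closure, duality makes ψ orthogonal to every finite vector, hence zero; so
the closure is the graph of an operator. -/
theorem Represents.graph_opExp {T : H →ₗ.[ℍᵐᵒᵖ] H} {p r : ℍ} (h : Represents e T p r) :
    (opExp T).graph = (expSeriesGraph T).topologicalClosure := by
  refine Submodule.toLinearPMap_graph_eq _ fun x hx hx1 => ?_
  refine eq_of_qinner_synth_eq e fun w => ?_
  have := h.qinner_exp (φ := x.1) (ψ := x.2) hx w
  rw [this, hx1, qinner_zero, qinner_zero]

/-- `exp X exp Y = exp (c / 2) exp (X + Y)` on finite vectors, for `[X, Y] = c`. -/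
theorem expVec_mem_expGraph_of_commutator {p r p' r' : ℍ} {c : ℝ}
    (h : ladder p r * ladder p' r' - ladder p' r' * ladder p r = c • 1) (w : ℕ →₀ ℍ) :
    (expVec e p' r' w, expVec e (p + p') (r + r') w <• (Real.exp (c / 2) : ℍ)) ∈
      expGraph e p r := by
  have hF := summable_synth_divPow_mul e p r p' r' w
  -- The double series is summed in two ways: here over the powers of X for a fixed power of Y, and
  -- in `hA` along antidiagonals, where the algebraic identity applies.
  have hX : HasSum (fun k => expVec e p r (divPow (ladder p' r') k w))
      (∑' x : ℕ × ℕ, synth e ((divPow (ladder p r) x.1 * divPow (ladder p' r') x.2) w)) :=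
    ((Equiv.prodComm ℕ ℕ).hasSum_iff.2 hF.hasSum).prod_fiberwise fun k =>
      hasSum_expVec e p r (divPow (ladder p' r') k w)
  have hA : ∑' x : ℕ × ℕ, synth e ((divPow (ladder p r) x.1 * divPow (ladder p' r') x.2) w) =
      expVec e (p + p') (r + r') w <• (Real.exp (c / 2) : ℍ) := by
    have hG : Summable fun x : ℕ × ℕ =>
        synth e (divPow (ladder (p + p') (r + r')) x.2 w) <• (gaussCoeff c x.1 : ℍ) := by
      refine Summable.of_norm ?_
      have h1 := (hasSum_gaussCoeff c).summable.norm.mul_of_nonneg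
        (summable_norm_synth_divPow e (p + p') (r + r') w) (fun _ => norm_nonneg _)
        fun _ => norm_nonneg _
      refine h1.congr fun x => ?_
      rw [norm_smul_right, Quaternion.norm_coe, mul_comm]
    have hG' := hG.hasSum.prod_fiberwise fun i =>
      (hasSum_expVec e (p + p') (r + r') w).const_smul (MulOpposite.op (gaussCoeff c i : ℍ))
    rw [(hasSum_realSMul _ (hasSum_gaussCoeff c)).unique hG']
    refine (hasSum_sum_antidiagonal hF.hasSum).unique ?_
    refine (hasSum_sum_antidiagonal hG.hasSum).congr_fun fun n => ?_
    have := LinearMap.congr_fun (sum_divPow_mul_divPow (R := Module.End ℍᵐᵒᵖ (ℕ →₀ ℍ)) h n) w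
    simp only [LinearMap.sum_apply, LinearMap.smul_apply, ladder_add] at this
    simp only [← synth_real_smul]
    rw [← map_sum, ← map_sum, this]
  rw [← hA]
  -- The vector exp(Y)w need not be finite, but its partial sums are, and their images under exp(X)
  -- converge; closedness of the graph gives the claim.
  have hS := (hasSum_expVec e p' r' w).prodMk hX
  exact (Submodule.isClosed_topologicalClosure _).mem_of_tendsto hS
    (Filter.Eventually.of_forall fun s => Submodule.sum_mem _ fun k _ =>
      expVec_mem_expGraph e p r _)

end Exponential

/-! ### Unitarity in the skew case, and the ordered products. -/

section Displacement

theorem mem_graph_opMul {H : Type*} [NormedAddCommGroup H] [Module ℍᵐᵒᵖ H] {S T : H →ₗ.[ℍᵐᵒᵖ] H} {φ χ ψ : H} (hT : (φ, χ) ∈ T.graph)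
    (hS : (χ, ψ) ∈ S.graph) : (φ, ψ) ∈ (opMul S T).graph := by
  obtain ⟨y, rfl, rfl⟩ := T.mem_graph_iff.1 hT
  obtain ⟨z, hz, rfl⟩ := S.mem_graph_iff.1 hS
  have hy : T ⟨y, y.2⟩ ∈ S.domain := by
    have := z.2
    rwa [hz] at this
  exact (opMul S T).mem_graph_iff.2 ⟨⟨y, y.2, hy⟩, rfl, congrArg S (Subtype.ext hz.symm)⟩

theorem exp_half_mul_exp_neg_half (c : ℝ) :
    ((Real.exp (c / 2) : ℝ) : ℍ) * ((Real.exp (-c / 2) : ℝ) : ℍ) = 1 := by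
  rw [← Quaternion.coe_mul, ← Real.exp_add, neg_div, add_neg_cancel, Real.exp_zero,
    Quaternion.coe_one]

theorem smul_exp_half_smul_exp_neg_half {H : Type*} [AddCommGroup H] [Module ℍᵐᵒᵖ H] (c : ℝ)
    (φ : H) : (φ <• ((Real.exp (c / 2) : ℝ) : ℍ)) <• ((Real.exp (-c / 2) : ℝ) : ℍ) = φ := by
  rw [smul_smul, ← MulOpposite.op_mul, exp_half_mul_exp_neg_half, MulOpposite.op_one, one_smul]

variable {H : Type*} [NormedAddCommGroup H] [Module ℍᵐᵒᵖ H] [RightQuatInnerSpace H]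
  {e : QuatHilbertBasis H} [CompleteSpace H]

theorem mem_graph_leftSMul {T : H →ₗ.[ℍᵐᵒᵖ] H} {φ ψ : H} (q : ℍ) (h : (φ, ψ) ∈ T.graph) :
    (φ, leftMul e q ψ) ∈ (leftSMul e q T).graph := by
  obtain ⟨y, rfl, rfl⟩ := T.mem_graph_iff.1 h
  exact (leftSMul e q T).mem_graph_iff.2 ⟨y, rfl, rfl⟩

theorem expVec_eq_synth {p r : ℍ} {w : ℕ →₀ ℍ} (h : ladder p r w = 0) :
    expVec e p r w = synth e w := by
  refine (hasSum_expVec e p r w).unique ?_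
  convert hasSum_single 0 fun n hn => ?_ using 1
  · simp [divPow_zero]
  · obtain ⟨m, rfl⟩ := Nat.exists_eq_succ_of_ne_zero hn
    rw [synth_divPow, pow_succ, Module.End.mul_apply, h, map_zero, map_zero, smul_zero]

/-- The hypothesis says that A = p·a† + r·a is skew, so the conjugate exponential is exp(-A).
Duality gives ⟨exp(A)w | exp(A)w⟩ = ⟨exp(-A)exp(A)w | w⟩, and exp(-A)exp(A)w = w is the commutator
identity with c = 0. -/
theorem Represents.norm_expVec {T : H →ₗ.[ℍᵐᵒᵖ] H} {p r : ℍ} (h : Represents e T p r)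
    (hr : star r = -p) (w : ℕ →₀ ℍ) : ‖expVec e p r w‖ = ‖synth e w‖ := by
  have hp : star p = -r := by rw [← star_star r, hr, star_neg, neg_neg]
  have h0 : ladder (-p) (-r) * ladder p r - ladder p r * ladder (-p) (-r) = (0 : ℝ) • 1 := by
    rw [← ladder_neg]
    exact neg_self_commutator (R := Module.End ℍᵐᵒᵖ (ℕ →₀ ℍ)) _
  have h1 := expVec_mem_expGraph_of_commutator (e := e) h0 w
  have hz : ladder (-p + p) (-r + r) w = 0 := by
    rw [neg_add_cancel, neg_add_cancel, ladder_zero, LinearMap.zero_apply]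
  rw [expVec_eq_synth hz, zero_div, Real.exp_zero, Quaternion.coe_one, MulOpposite.op_one,
    one_smul, ← hr, ← hp] at h1
  have h2 := h.qinner_eq_of_mem (Submodule.le_topologicalClosure _ (h.mem_expSeriesGraph w)) h1
  rw [qinner_self, qinner_self, Quaternion.coe_inj] at h2
  exact (pow_left_inj₀ (norm_nonneg _) (norm_nonneg _) two_ne_zero).1 h2

/-- By the isometry, finite approximations of φ have Cauchy images. -/
theorem Represents.exists_mem_expGraph {T : H →ₗ.[ℍᵐᵒᵖ] H} {p r : ℍ} (h : Represents e T p r)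
    (hr : star r = -p) (φ : H) : ∃ ψ, (φ, ψ) ∈ expGraph e p r := by
  obtain ⟨x, hx, hφ⟩ := mem_closure_iff_seq_limit.1 (denseRange_synth e φ)
  choose v hv using hx
  obtain rfl : (fun n => synth e (v n)) = x := funext hv
  have hd : ∀ m n, dist (expVec e p r (v m)) (expVec e p r (v n)) =
      dist (synth e (v m)) (synth e (v n)) := fun m n => by
    rw [dist_eq_norm, dist_eq_norm, ← map_sub, ← map_sub, h.norm_expVec hr]
  have hc : CauchySeq fun n => expVec e p r (v n) := by
    have := hφ.cauchySeq
    rw [Metric.cauchySeq_iff] at this ⊢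
    simpa only [hd] using this
  obtain ⟨ψ, hψ⟩ := cauchySeq_tendsto_of_complete hc
  exact ⟨ψ, (Submodule.isClosed_topologicalClosure _).mem_of_tendsto (hφ.prodMk_nhds hψ)
    (Filter.Eventually.of_forall fun n => expVec_mem_expGraph e p r (v n))⟩

theorem Represents.expGraph_le_graph {T : H →ₗ.[ℍᵐᵒᵖ] H} {p r : ℍ} (h : Represents e T p r) :
    expGraph e p r ≤ (opExp T).graph :=
  h.expGraph_le.trans h.graph_opExp.ge

theorem Represents.domain_opExp {T : H →ₗ.[ℍᵐᵒᵖ] H} {p r : ℍ} (h : Represents e T p r)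
    (hr : star r = -p) : (opExp T).domain = ⊤ := by
  refine eq_top_iff.2 fun φ _ => ?_
  obtain ⟨ψ, hψ⟩ := h.exists_mem_expGraph hr φ
  exact LinearPMap.mem_domain_of_mem_graph (h.expGraph_le_graph hψ)

section Product

variable {TX TY TA : H →ₗ.[ℍᵐᵒᵖ] H} {p r p' r' : ℍ} {c : ℝ}

/-- The product `e^{-c/2} e^X e^Y` extends `e^{X+Y}` on finite vectors, for `[X, Y] = c`. -/
theorem expVec_mem_graph_product (hX : Represents e TX p r) (hY : Represents e TY p' r')
    (hc : ladder p r * ladder p' r' - ladder p' r' * ladder p r = c • 1) (w : ℕ →₀ ℍ) :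
    (synth e w, expVec e (p + p') (r + r') w) ∈
      (leftSMul e ((Real.exp (-c / 2) : ℝ) : ℍ) (opMul (opExp TX) (opExp TY))).graph := by
  have h := mem_graph_leftSMul (e := e) ((Real.exp (-c / 2) : ℝ) : ℍ)
    (mem_graph_opMul (hY.expGraph_le_graph (expVec_mem_expGraph e p' r' w))
      (hX.expGraph_le_graph (expVec_mem_expGraph_of_commutator hc w)))
  rwa [leftMul_coe, smul_exp_half_smul_exp_neg_half] at h

/-- Paired with a finite vector w, e^X e^Y φ becomes φ paired with exp(Y*) exp(X*) w = e^{c/2}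
exp((X+Y)*) w, and the prefactor cancels e^{c/2}. Hence the commutator assumed is that of the
adjoints Y*, X*. -/
theorem product_le_opExp (hX : Represents e TX p r) (hY : Represents e TY p' r')
    (hA : Represents e TA (p + p') (r + r')) (hskew : star (r + r') = -(p + p'))
    (hc : ladder (star r') (star p') * ladder (star r) (star p) -
      ladder (star r) (star p) * ladder (star r') (star p') = c • 1) :
    leftSMul e ((Real.exp (-c / 2) : ℝ) : ℍ) (opMul (opExp TX) (opExp TY)) ≤ opExp TA := by
  refine LinearPMap.le_of_le_graph ?_
  rintro ⟨φ, ψ⟩ hφ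
  obtain ⟨y, rfl, rfl⟩ := (LinearPMap.mem_graph_iff _).1 hφ
  obtain ⟨ψA, hψA⟩ := hA.exists_mem_expGraph hskew (y : H)
  have hψA' := hA.expGraph_le hψA
  have hy := (opExp TY).mem_graph ⟨y, y.2.1⟩
  have hz := (opExp TX).mem_graph ⟨_, y.2.2⟩
  rw [hY.graph_opExp] at hy
  rw [hX.graph_opExp] at hz
  have key : leftSMul e ((Real.exp (-c / 2) : ℝ) : ℍ) (opMul (opExp TX) (opExp TY)) y = ψA := by
    change leftMul e ((Real.exp (-c / 2) : ℝ) : ℍ)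
      (opExp TX ⟨opExp TY ⟨(y : H), y.2.1⟩, y.2.2⟩) = ψA
    refine eq_of_qinner_synth_eq e fun w => ?_
    rw [leftMul_coe, qinner_smul, hX.qinner_exp hz w, hA.qinner_exp hψA' w,
      hY.qinner_eq_of_mem hy (expVec_mem_expGraph_of_commutator hc w), qinner_realSMul_left,
      qinner_smul, mul_assoc, exp_half_mul_exp_neg_half, mul_one, star_add, star_add,
      add_comm (star r'), add_comm (star p')]
  rw [key]
  exact hA.expGraph_le_graph hψA

theorem closure_product_eq_opExp (hX : Represents e TX p r) (hY : Represents e TY p' r')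
    (hA : Represents e TA (p + p') (r + r')) (hskew : star (r + r') = -(p + p'))
    (hc : ladder p r * ladder p' r' - ladder p' r' * ladder p r = c • 1)
    (hc' : ladder (star r') (star p') * ladder (star r) (star p) -
      ladder (star r) (star p) * ladder (star r') (star p') = c • 1) :
    Submodule.span ℍᵐᵒᵖ (Set.range e.vec) ≤
        (leftSMul e ((Real.exp (-c / 2) : ℝ) : ℍ) (opMul (opExp TX) (opExp TY))).domain ∧
      leftSMul e ((Real.exp (-c / 2) : ℝ) : ℍ) (opMul (opExp TX) (opExp TY)) ≤ opExp TA ∧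
      (leftSMul e ((Real.exp (-c / 2) : ℝ) : ℍ)
        (opMul (opExp TX) (opExp TY))).graph.topologicalClosure = (opExp TA).graph := by
  have hle := product_le_opExp hX hY hA hskew hc'
  refine ⟨?_, hle, le_antisymm ?_ ?_⟩
  · rw [← range_synth]
    rintro _ ⟨w, rfl⟩
    exact LinearPMap.mem_domain_of_mem_graph (expVec_mem_graph_product hX hY hc w)
  · refine Submodule.topologicalClosure_minimal _ (LinearPMap.le_graph_of_le hle) ?_
    rw [hA.graph_opExp]
    exact Submodule.isClosed_topologicalClosure _
  · rintro ⟨φ, ψ⟩ hφ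
    obtain ⟨ψ', hψ'⟩ := hA.exists_mem_expGraph hskew φ
    -- Since `expGraph` already has a value at every φ, single-valuedness puts the whole graph of
    -- e^A inside it.
    obtain rfl : ψ = ψ' := LinearPMap.mem_graph_snd_inj _ hφ (hA.expGraph_le_graph hψ') rfl
    exact expGraph_le_of_forall (Submodule.isClosed_topologicalClosure _)
      (fun w => Submodule.le_topologicalClosure _ (expVec_mem_graph_product hX hY hc w)) hψ'

end Product

/-! ### The concrete operators and the vacuum vector. -/

theorem represents_raise (q : ℍ) : Represents e (leftSMul e q (creation e)) q 0 := by
  simpa using represents_creation.leftSMul q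

theorem represents_lower (q : ℍ) :
    Represents e (-leftSMul e (star q) (annihilation e)) 0 (-star q) := by
  simpa using (represents_annihilation.leftSMul (star q)).neg

theorem represents_displacement (q : ℍ) : Represents e
    (leftSMul e q (creation e) - leftSMul e (star q) (annihilation e)) q (-star q) := by
  simpa using (represents_creation.leftSMul q).sub (represents_annihilation.leftSMul (star q))

theorem ladder_commutator_displacement (q : ℍ) :
    ladder q 0 * ladder 0 (-star q) - ladder 0 (-star q) * ladder q 0 = (‖q‖ ^ 2) • 1 := by
  have h1 : q * -star q = ((-‖q‖ ^ 2 : ℝ) : ℍ) := by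
    rw [mul_neg, Quaternion.self_mul_star, Quaternion.normSq_eq_norm_mul_self, ← sq,
      ← Quaternion.coe_neg]
  have h2 : -star q * q = ((-‖q‖ ^ 2 : ℝ) : ℍ) := by
    rw [neg_mul, star_mul_self_eq, ← Quaternion.coe_neg]
  rw [ladder_commutator h1 h2, neg_neg]

theorem ladder_pow_single_zero (q : ℍ) (n : ℕ) : (ladder q 0 ^ n) (Finsupp.single 0 1) =
    Finsupp.single n (Real.sqrt n.factorial • q ^ n) := by
  induction n with
  | zero => simp
  | succ n ih =>
    rw [pow_succ', Module.End.mul_apply, ih, ladder_single, zero_mul, smul_zero,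
      Finsupp.single_zero, add_zero, mul_smul_comm, smul_smul, pow_succ', Nat.factorial_succ,
      Nat.cast_mul, Real.sqrt_mul (by positivity), Nat.cast_succ]

theorem expVec_raise_vacuum (q : ℍ) : expVec e q 0 (Finsupp.single 0 1) =
    ∑' m : ℕ, e.vec m <• (((Real.sqrt m.factorial)⁻¹ : ℝ) * q ^ m : ℍ) := by
  refine tsum_congr fun m => ?_
  rw [synth_divPow, ladder_pow_single_zero, synth_single, smul_smul, ← MulOpposite.op_mul,
    ← Quaternion.coe_mul_eq_smul, ← Quaternion.coe_commutes, ← mul_assoc, ← Quaternion.coe_mul]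
  congr 4
  have h : Real.sqrt m.factorial * Real.sqrt m.factorial = m.factorial :=
    Real.mul_self_sqrt (by positivity)
  have h' : Real.sqrt m.factorial ≠ 0 := (Real.sqrt_pos.2 (by positivity)).ne'
  rw [inv_mul_eq_iff_eq_mul₀ (by positivity), eq_mul_inv_iff_mul_eq₀ h', h]

/-- The lowering part kills e₀, so its exponential fixes e₀, and normal ordering leaves only the
exponential of q·a†. -/
theorem expVec_displacement_vacuum (q : ℍ) :
    expVec e q (-star q) (Finsupp.single 0 1) = coherentState e q := by
  have h := expVec_mem_expGraph_of_commutator (e := e) (ladder_commutator_displacement q)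
    (Finsupp.single 0 1)
  rw [expVec_eq_synth (by simp [ladder_single]), add_zero, zero_add] at h
  have h' := LinearPMap.mem_graph_snd_inj _ ((represents_raise q).expGraph_le_graph h)
    ((represents_raise q).expGraph_le_graph (expVec_mem_expGraph e q 0 _)) rfl
  rw [coherentState, ← expVec_raise_vacuum, ← h', smul_exp_half_smul_exp_neg_half]

end Displacement

end QuatFock

theorem mainTheorem7 {H : Type*} [NormedAddCommGroup H] [Module ℍᵐᵒᵖ H]
    [QuatFock.RightQuatInnerSpace H] [CompleteSpace H] (e : QuatFock.QuatHilbertBasis H) (q : ℍ) :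
    ((QuatFock.displacement e q).domain = ⊤) ∧
    (Submodule.span ℍᵐᵒᵖ (Set.range e.vec) ≤ (QuatFock.normalOrdered e q).domain ∧
      QuatFock.normalOrdered e q ≤ QuatFock.displacement e q ∧
      (QuatFock.normalOrdered e q).graph.topologicalClosure =
        (QuatFock.displacement e q).graph) ∧
    (Submodule.span ℍᵐᵒᵖ (Set.range e.vec) ≤ (QuatFock.antiNormalOrdered e q).domain ∧
      QuatFock.antiNormalOrdered e q ≤ QuatFock.displacement e q ∧
      (QuatFock.antiNormalOrdered e q).graph.topologicalClosure =
        (QuatFock.displacement e q).graph) ∧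
    ∃ h : e.vec 0 ∈ (QuatFock.displacement e q).domain,
      QuatFock.displacement e q ⟨e.vec 0, h⟩ = QuatFock.coherentState e q := by
  have hX := QuatFock.represents_raise (e := e) q
  have hY := QuatFock.represents_lower (e := e) q
  have hA := QuatFock.represents_displacement (e := e) q
  have hc := QuatFock.ladder_commutator_displacement q
  -- The adjoints of -q̄·a and q·a† are -q·a† and q̄·a, which is the same pair of operators with -q
  -- in place of q.
  have hc' := QuatFock.ladder_commutator_displacement (-q)
  rw [norm_neg] at hc'
  refine ⟨hA.domain_opExp (by simp), ?_, ?_, ?_⟩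
  · exact QuatFock.closure_product_eq_opExp hX hY (by simpa using hA) (by simp) hc
      (by simpa using hc')
  -- Exchanging the factors replaces c by -|q|², which turns the prefactor into e^{|q|²/2}.
  · have h := QuatFock.closure_product_eq_opExp hY hX (by simpa using hA) (by simp)
      (QuatFock.commutator_swap (R := Module.End ℍᵐᵒᵖ (ℕ →₀ ℍ)) hc)
      (QuatFock.commutator_swap (R := Module.End ℍᵐᵒᵖ (ℕ →₀ ℍ)) (by simpa using hc'))
    rw [neg_neg] at h
    exact h
  · have h := hA.expGraph_le_graph (QuatFock.expVec_mem_expGraph e q (-star q) (Finsupp.single 0 1))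
    rw [QuatFock.synth_single_one, QuatFock.expVec_displacement_vacuum] at h
    obtain ⟨y, hy, hy'⟩ := (LinearPMap.mem_graph_iff _).1 h
    obtain ⟨y, hyd⟩ := y
    simp only at hy
    subst hy
    exact ⟨hyd, hy'⟩
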